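/- Let $\mathbb{Z}_+=\{1,2,\dots\}$. A picture over a finite alphabet $A$ is a map $p:\{0,\dots,m-1\}\times\{0,\dots,n-1\}\to A$ with $m,n\ge 1$; its shape is $(m,n)$, where $m$ is the width and $n$ the height. Its padding $\hat p$ is the $(m+2)\times(n+2)$ array obtained by surrounding $p$ with one layer of a symbol $\#\notin A$. A domino language over $A$ is the set of all pictures $p$ over $A$ such that $\hat p$ contains none of a given set of forbidden horizontal ($2\times 1$) and vertical ($1\times 2$) dominoes over $A\cup\{\#\}$. A picture language is recognizable if it is the image of a domino language over a finite alphabet under a symbol-by-symbol projection. A function $f:\mathbb{Z}_+\to\mathbb{Z}_+$ is recognizable if the language consisting of the one-letter pictures of shapes $(n,f(n))$, $n\in\mathbb{Z}_+$, is recognizable. A $\mathbb{Z}^2$-SFT over a finite alphabet $A$ is a set $X\subseteq A^{\mathbb{Z}^2}$ of the form: all configurations in which no translate of any pattern from a given finite set of finite patterns occurs. For $n\in\mathbb{N}$, let $\mathcal{L}_n(X)$ be the set of $n\times n$ patterns that occur on $\{0,\dots,n-1\}^2$ in some configuration of $X$. Let $B_H(n)\in\mathbb{N}\cup\{\infty\}$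 be the least $k\in\mathbb{N}$ such that for all $p,q\in\mathcal{L}_n(X)$ some $x\in X$ contains $p$ on $\{0,\dots,n-1\}^2$ and $q$ on $(n+k,0)+\{0,\dots,n-1\}^2$, that is, $q$ lies to the right of $p$ with a gap of exactly $k$ columns, and let $B_H(n)=\infty$ if no such $k$ exists. Define $B_V(n)$ in the same way with $(0,n+k)$ in place of $(n+k,0)$, and let $B(n)=\max(B_H(n),B_V(n))$; $B$ is the block gluing function of $X$. Write $u(n)\approx v(n)$ if $u(n)/v(n)\to 1$ as $n\to\infty$. **Theorem.** Let $f:\mathbb{Z}_+\to\mathbb{Z}_+$ be a nondecreasing recognizable function. Then there exists a $\mathbb{Z}^2$-SFT (over some finite alphabet) such that $$B(n)\approx f(n),\qquad B_V(n)\approx f(n),\qquad B_H(n)\approx f(n).$$ -/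

import Mathlib

open Filter Topology
open scoped ENNReal

namespace BlockGluing

/-! ### Pictures and recognizable picture languages -/

/-- A (nonempty) picture over `A`: the first coordinate is horizontal and the second coordinate
increases upward. -/
structure Picture (A : Type) where
  width : ℕ+
  height : ℕ+
  cell : Fin width → Fin height → A

namespace Picture

/-- The symbolwise projection of a picture along `π`. -/
def map {A B : Type} (π : A → B) (p : Picture A) : Picture B where
  width := p.width
  height := p.height
  cell i j := π (p.cell i j)

/-- The padded picture. Its domain is `{0, …, m + 1} × {0, …, n + 1}` where `m × n` is the shape of
`p` (values outside this domain are never used); `none` plays the role of the border symbol. -/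
def padded {A : Type} (p : Picture A) (i j : ℕ) : Option A :=
  if h : (1 ≤ i ∧ i ≤ p.width) ∧ (1 ≤ j ∧ j ≤ p.height) then
    some (p.cell ⟨i - 1, by omega⟩ ⟨j - 1, by omega⟩)
  else none

/-- The unique picture of shape `(m, n)` over a one-letter alphabet. -/
def una (m n : ℕ+) : Picture Unit where
  width := m
  height := n
  cell _ _ := ()

end Picture

/-- The pictures whose padding contains no horizontal domino from `H` (pairs: left, right) and no
vertical domino from `V` (pairs: lower, upper). -/
def dominoLanguage {A : Type} (H V : Set (Option A × Option A)) : Set (Picture A) :=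
  {p | (∀ i j : ℕ, i + 1 < p.width + 2 → j < p.height + 2 →
          (p.padded i j, p.padded (i + 1) j) ∉ H) ∧
       (∀ i j : ℕ, i < p.width + 2 → j + 1 < p.height + 2 →
          (p.padded i j, p.padded i (j + 1)) ∉ V)}

/-- A picture language is recognizable if it is a symbolwise projection of a domino language over
some finite alphabet. -/
def IsRecognizable {A : Type} (L : Set (Picture A)) : Prop :=
  ∃ (B : Type) (_ : Finite B) (H V : Set (Option B × Option B)) (π : B → A),
    L = Picture.map π '' dominoLanguage H V

/-- A function is recognizable if the one-letter picture language whose set of shapes is the graph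
of the function is recognizable. -/
def IsRecognizableFunction (f : ℕ+ → ℕ+) : Prop :=
  IsRecognizable {p : Picture Unit | ∃ n : ℕ+, p = Picture.una n (f n)}

/-! ### Two-dimensional shifts of finite type -/

/-- Configurations of the plane `ℤ²`. -/
abbrev Config (A : Type) : Type := ℤ × ℤ → A

/-- Patterns with finite domain `D`. -/
abbrev Pattern (A : Type) (D : Finset (ℤ × ℤ)) : Type := D → A

/-- The shift action of `ℤ²`. -/
def shift {A : Type} (v : ℤ × ℤ) (x : Config A) : Config A := fun n => x (n + v)

/-- The cylinder set of a finite pattern. -/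
def cylinder {A : Type} {D : Finset (ℤ × ℤ)} (p : Pattern A D) : Set (Config A) :=
  {x | ∀ v : D, x v = p v}

/-- The subshift defined by a set of forbidden finite patterns. -/
def subshiftOf {A : Type} (F : Set (Σ D : Finset (ℤ × ℤ), Pattern A D)) : Set (Config A) :=
  {x | ∀ v : ℤ × ℤ, ∀ p ∈ F, shift v x ∉ cylinder p.2}

/-- `X` is defined by finitely many forbidden finite patterns. -/
def IsSFT {A : Type} (X : Set (Config A)) : Prop :=
  ∃ F : Set (Σ D : Finset (ℤ × ℤ), Pattern A D), F.Finite ∧ X = subshiftOf F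

/-! ### Block gluing functions -/

/-- The square `{0, …, n - 1}²`. -/
noncomputable def square (n : ℕ) : Finset (ℤ × ℤ) := Finset.Ico (0 : ℤ) n ×ˢ Finset.Ico (0 : ℤ) n

/-- The globally valid `n × n` patterns of `X`. -/
noncomputable def squareLanguage {A : Type} (X : Set (Config A)) (n : ℕ) : Set (Pattern A (square n)) :=
  {p | (X ∩ cylinder p).Nonempty}

/-- Any two globally valid `n × n` patterns `p`, `q` occur together in a configuration of `X`, with
`p` at the origin and `q` at position `v`. -/
def GluesAt {A : Type} (X : Set (Config A)) (n : ℕ) (v : ℤ × ℤ) : Prop :=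
  ∀ p ∈ squareLanguage X n, ∀ q ∈ squareLanguage X n,
    (X ∩ cylinder p ∩ shift (-v) '' cylinder q).Nonempty

/-- The horizontal block gluing function: the least `k` such that any two globally valid `n × n`
patterns can be glued next to each other with a horizontal gap of `k` columns
(`⊤` if there is no such `k`). -/
noncomputable def horizontalGluing {A : Type} (X : Set (Config A)) (n : ℕ) : ℕ∞ :=
  ⨅ (k : ℕ) (_ : GluesAt X n ((n : ℤ) + k, 0)), (k : ℕ∞)

/-- The vertical block gluing function. -/
noncomputable def verticalGluing {A : Type} (X : Set (Config A)) (n : ℕ) : ℕ∞ :=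
  ⨅ (k : ℕ) (_ : GluesAt X n (0, (n : ℤ) + k)), (k : ℕ∞)

/-- The block gluing function. -/
noncomputable def blockGluing {A : Type} (X : Set (Config A)) (n : ℕ) : ℕ∞ :=
  max (horizontalGluing X n) (verticalGluing X n)

/-- `u(n) / f(n) → 1` as `n → ∞`. The quotient is taken in `[0, ∞]`, where the denominator is always
positive and finite. -/
def AsymptoticTo (u : ℕ → ℕ∞) (f : ℕ+ → ℕ+) : Prop :=
  Tendsto (fun n : ℕ+ => ((u n : ℕ∞) : ℝ≥0∞) / ((f n : ℕ) : ℝ≥0∞)) atTop (𝓝 1)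

end BlockGluing

namespace BlockGluing

/-! ### Domino systems -/

/-! A nondecreasing `f` is eventually constant or tends to infinity. In the first case `sparseShift
c` has gluing functions exactly `c`. In the second, bounded additive errors are harmless, and gluing
is slowed down by pictures that must be completed inside the gap.

Folding pairs of rows turns a domino system for `f` into one for `G = ⌈f / 2⌉` (`Realizes.pair`). A
lexicographically increasing layer then bounds the number of rows of given width that can be stacked
(`Realizes.lex`, `nilpotent_lex`). In `pictureShift` the pictures float among blanks. A row with
both ends marked must continue up and down to a top and a bottom row, so it lies in a complete
picture of height `G m` (`IsRow.exists_isBlock`, `IsBlock.height_eq`). A row with an unmarked end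
may be cut off anywhere, the adjacent blanks carrying a bit that points to that end.

Lower bound (`le_of_gluesAt_pictureShift`): a bottom row of width `n` at the top of the lower square
and a top row at the bottom of the upper square force two disjoint pictures, of total height `2 * G
n`, about `f n`. Upper bound (`gluesAt_pictureShift`): `patch` completes a square pattern to a
configuration that is blank outside the same columns and `G n` further rows on either side.
Horizontal gluing is therefore cheap, and the product with the transpose makes both directions
behave alike. -/

/-- The word `u 0, …, u (n - 1)`, padded by one border symbol on each side, has only pairs of
neighbours related by `R`. -/
def LineOK {B : Type} (R : Option B → Option B → Prop) (n : ℕ) (u : ℕ → B) : Prop :=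
  R none (u 0) ∧ (∀ i, i + 1 < n → R (u i) (u (i + 1))) ∧ R (u (n - 1)) none

/-- `c` is a picture of shape `(m, h)` all of whose padded rows and columns are admissible. -/
def IsPic {B : Type} (H V : Option B → Option B → Prop) (m h : ℕ) (c : ℕ → ℕ → B) : Prop :=
  (∀ j < h, LineOK H m fun i => c i j) ∧ ∀ i < m, LineOK V h fun j => c i j

/-- The shapes of the admissible pictures form the graph of `F`. -/
def Realizes {B : Type} (H V : Option B → Option B → Prop) (F : ℕ → ℕ) : Prop :=
  ∀ m h, 0 < m → 0 < h → ((∃ c, IsPic H V m h c) ↔ h = F m)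

theorem Picture.padded_eq_none {A : Type} (p : Picture A) {i j : ℕ}
    (h : i = 0 ∨ j = 0 ∨ (p.width : ℕ) < i ∨ (p.height : ℕ) < j) : p.padded i j = none := by
  rw [Picture.padded, dif_neg]
  omega

theorem Picture.padded_succ {A : Type} (p : Picture A) {i j : ℕ} (hi : i < p.width)
    (hj : j < p.height) : p.padded (i + 1) (j + 1) = some (p.cell ⟨i, hi⟩ ⟨j, hj⟩) := by
  rw [Picture.padded, dif_pos (by omega)]
  rfl

/-- Lines lying wholly in the border contain only the domino `(none, none)`, which `IsPic` does not
test; this is why it must be allowed. -/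
theorem mem_dominoLanguage_iff {B : Type} {H V : Set (Option B × Option B)}
    (hH : (none, none) ∉ H) (hV : (none, none) ∉ V) (p : Picture B) (c : ℕ → ℕ → B)
    (hc : ∀ (i j : ℕ) (hi : i < p.width) (hj : j < p.height), p.cell ⟨i, hi⟩ ⟨j, hj⟩ = c i j) :
    p ∈ dominoLanguage H V ↔
      IsPic (fun a b => (a, b) ∉ H) (fun a b => (a, b) ∉ V) p.width p.height c := by
  have hw := p.width.pos
  have hh := p.height.pos
  have hs : ∀ i j : ℕ, i < p.width → j < p.height → p.padded (i + 1) (j + 1) = some (c i j) :=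
    fun i j hi hj => by rw [p.padded_succ hi hj, hc]
  have hn := fun i j => @Picture.padded_eq_none _ p i j
  constructor
  · rintro ⟨h1, h2⟩
    refine ⟨fun j hj => ⟨?_, fun i hi => ?_, ?_⟩, fun i hi => ⟨?_, fun j hj => ?_, ?_⟩⟩
    · have := h1 0 (j + 1) (by omega) (by omega)
      rwa [hn _ _ (by omega), hs _ _ hw hj] at this
    · have := h1 (i + 1) (j + 1) (by omega) (by omega)
      rwa [hs _ _ (by omega) hj, hs _ _ (by omega) hj] at this
    · have := h1 (p.width - 1 + 1) (j + 1) (by omega) (by omega)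
      rwa [hs _ _ (by omega) hj, hn _ _ (by omega)] at this
    · have := h2 (i + 1) 0 (by omega) (by omega)
      rwa [hn _ _ (by omega), hs _ _ hi hh] at this
    · have := h2 (i + 1) (j + 1) (by omega) (by omega)
      rwa [hs _ _ hi (by omega), hs _ _ hi (by omega)] at this
    · have := h2 (i + 1) (p.height - 1 + 1) (by omega) (by omega)
      rwa [hs _ _ hi (by omega), hn _ _ (by omega)] at this
  · rintro ⟨h1, h2⟩
    refine ⟨fun i j hi hj => ?_, fun i j hi hj => ?_⟩
    · rcases j with _ | j
      · rwa [hn _ _ (by omega), hn _ _ (by omega)]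
      rcases Nat.lt_or_ge j p.height with hj' | hj'
      · obtain ⟨ha, hb, hd⟩ := h1 j hj'
        rcases i with _ | i
        · rwa [hn _ _ (by omega), hs _ _ hw hj']
        rcases Nat.lt_or_ge (i + 1) p.width with hi' | hi'
        · rw [hs _ _ (by omega) hj', hs _ _ hi' hj']
          exact hb i hi'
        · rw [hs _ _ (by omega) hj', hn _ _ (by omega)]
          rwa [show (p.width : ℕ) - 1 = i by omega] at hd
      · rwa [hn _ _ (by omega), hn _ _ (by omega)]
    · rcases i with _ | i
      · rwa [hn _ _ (by omega), hn _ _ (by omega)]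
      rcases Nat.lt_or_ge i p.width with hi' | hi'
      · obtain ⟨ha, hb, hd⟩ := h2 i hi'
        rcases j with _ | j
        · rwa [hn _ _ (by omega), hs _ _ hi' hh]
        rcases Nat.lt_or_ge (j + 1) p.height with hj' | hj'
        · rw [hs _ _ hi' (by omega), hs _ _ hi' hj']
          exact hb j hj'
        · rw [hs _ _ hi' (by omega), hn _ _ (by omega)]
          rwa [show (p.height : ℕ) - 1 = j by omega] at hd
      · rwa [hn _ _ (by omega), hn _ _ (by omega)]

theorem IsRecognizableFunction.exists_realizes {f : ℕ+ → ℕ+} (hf : IsRecognizableFunction f) :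
    ∃ (B : Type) (_ : Finite B) (H V : Option B → Option B → Prop),
      Realizes H V fun m => f m.toPNat' := by
  obtain ⟨B, hB, H, V, π, hL⟩ := hf
  have key : ∀ m h : ℕ+, h = f m ↔
      ∃ p ∈ dominoLanguage H V, p.width = m ∧ p.height = h := by
    intro m h
    have h1 : Picture.una m h ∈ {p : Picture Unit | ∃ n : ℕ+, p = Picture.una n (f n)} ↔
        h = f m := by
      constructor
      · rintro ⟨n, hn⟩
        have e1 : m = n := congrArg Picture.width hn
        have e2 : h = f n := congrArg Picture.height hn
        rw [e1, e2]
      · rintro rfl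
        exact ⟨m, rfl⟩
    rw [← h1, hL]
    constructor
    · rintro ⟨p, hp, hpm⟩
      exact ⟨p, hp, congrArg Picture.width hpm, congrArg Picture.height hpm⟩
    · rintro ⟨p, hp, rfl, rfl⟩
      exact ⟨p, hp, rfl⟩
  -- Every padding contains `(none, none)` in both directions; since some picture is accepted,
  -- neither rule forbids it.
  obtain ⟨p, ⟨hp1, hp2⟩, -⟩ := (key 1 (f 1)).1 rfl
  have hH : (none, none) ∉ H := by
    have := hp1 0 0 (by omega) (by omega)
    rwa [p.padded_eq_none (by omega), p.padded_eq_none (by omega)] at this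
  have hV : (none, none) ∉ V := by
    have := hp2 0 0 (by omega) (by omega)
    rwa [p.padded_eq_none (by omega), p.padded_eq_none (by omega)] at this
  refine ⟨B, hB, fun a b => (a, b) ∉ H, fun a b => (a, b) ∉ V, fun m h hm hh => ?_⟩
  lift m to ℕ+ using hm
  lift h to ℕ+ using hh
  rw [show (fun m : ℕ => (f m.toPNat' : ℕ)) m = f m by simp, PNat.coe_inj, key]
  constructor
  · rintro ⟨c, hc⟩
    exact ⟨⟨m, h, fun i j => c i j⟩,
      (mem_dominoLanguage_iff hH hV _ c fun _ _ _ _ => rfl).2 hc, rfl, rfl⟩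
  · rintro ⟨p, hp, rfl, rfl⟩
    classical
    refine ⟨fun i j => if hij : i < p.width ∧ j < p.height then p.cell ⟨i, hij.1⟩ ⟨j, hij.2⟩
      else p.cell ⟨0, p.width.pos⟩ ⟨0, p.height.pos⟩,
      (mem_dominoLanguage_iff hH hV p _ fun i j hi hj => ?_).1 hp⟩
    rw [dif_pos ⟨hi, hj⟩]

/-! ### Two rows in one -/

/-- Horizontal rule for pictures whose cells hold two vertically adjacent cells, the upper of which
may be missing. -/
def pairH {B : Type} (H : Option B → Option B → Prop) : Option (B × Option B) →
    Option (B × Option B) → Prop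
  | none, none => True
  | none, some x => H none x.1 ∧ ∀ c, x.2 = some c → H none (some c)
  | some x, none => H x.1 none ∧ ∀ c, x.2 = some c → H (some c) none
  | some x, some y => H x.1 y.1 ∧ (x.2 = none ↔ y.2 = none) ∧
      ∀ c d, x.2 = some c → y.2 = some d → H (some c) (some d)

/-- Vertical rule for pictures whose cells hold two vertically adjacent cells, the upper of which
may be missing. -/
def pairV {B : Type} (V : Option B → Option B → Prop) : Option (B × Option B) →
    Option (B × Option B) → Prop
  | none, none => True
  | none, some y => V none y.1 ∧ ∀ c, y.2 = some c → V y.1 (some c)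
  | some x, none => V (some (x.2.getD x.1)) none
  | some x, some y => (∃ c, x.2 = some c ∧ V (some c) y.1) ∧ ∀ c, y.2 = some c → V y.1 (some c)

theorem IsPic.pair {B : Type} {H V : Option B → Option B → Prop} {m h : ℕ} {c : ℕ → ℕ → B}
    (hh : 0 < h) (hc : IsPic H V m h c) :
    IsPic (pairH H) (pairV V) m ((h + 1) / 2)
      fun i j => (c i (2 * j), if 2 * j + 1 < h then some (c i (2 * j + 1)) else none) := by
  obtain ⟨hr, hv⟩ := hc
  refine ⟨fun j hj => ⟨⟨(hr (2 * j) (by omega)).1, ?_⟩, fun i hi => ⟨?_, ?_, ?_⟩, ?_, ?_⟩,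
    fun i hi => ⟨⟨(hv i hi).1, ?_⟩, fun j hj => ⟨?_, ?_⟩, ?_⟩⟩
  · intro d hd
    dsimp only at hd
    split_ifs at hd with h1
    rw [← hd]
    exact (hr _ h1).1
  · exact (hr (2 * j) (by omega)).2.1 i hi
  · dsimp only
    split_ifs <;> simp
  · intro d d' hd hd'
    dsimp only at hd hd'
    split_ifs at hd hd' with h1
    rw [← hd, ← hd']
    exact (hr _ h1).2.1 i hi
  · exact (hr (2 * j) (by omega)).2.2
  · intro d hd
    dsimp only at hd
    split_ifs at hd with h1
    rw [← hd]
    exact (hr _ h1).2.2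
  · intro d hd
    dsimp only at hd
    split_ifs at hd with h1
    rw [← hd]
    exact (hv i hi).2.1 _ h1
  · refine ⟨c i (2 * j + 1), if_pos (by omega), ?_⟩
    exact (hv i hi).2.1 (2 * j + 1) (by omega)
  · intro d hd
    dsimp only at hd
    split_ifs at hd with h1
    rw [← hd]
    exact (hv i hi).2.1 _ h1
  · have := (hv i hi).2.2
    dsimp only [pairV]
    split_ifs with h1
    · rwa [show h - 1 = 2 * ((h + 1) / 2 - 1) + 1 by omega] at this
    · rwa [show h - 1 = 2 * ((h + 1) / 2 - 1) by omega] at this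

theorem IsPic.unpair {B : Type} {H V : Option B → Option B → Prop} {m g : ℕ}
    {c : ℕ → ℕ → B × Option B} (hm : 0 < m) (hg : 0 < g)
    (hc : IsPic (pairH H) (pairV V) m g c) :
    ∃ h d, (h + 1) / 2 = g ∧ IsPic H V m h d := by
  obtain ⟨hr, hv⟩ := hc
  have hsync : ∀ i < m, ((c i (g - 1)).2 = none ↔ (c 0 (g - 1)).2 = none) := by
    intro i
    induction i with
    | zero => simp
    | succ i ih =>
      intro hi
      rw [← ih (by omega)]
      exact ((hr (g - 1) (by omega)).2.1 i hi).2.1.symm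
  have hsome : ∀ i < m, ∀ j, j + 1 < g → ∃ b, (c i j).2 = some b := fun i hi j hj =>
    let ⟨b, hb, _⟩ := ((hv i hi).2.1 j hj).1
    ⟨b, hb⟩
  -- Only the top row can lack upper cells, and by `hsync` it lacks all or none of them, so column
  -- `0` decides the parity of the unfolded height.
  set h : ℕ := if (c 0 (g - 1)).2 = none then 2 * g - 1 else 2 * g with hh
  have hh2 : h ≤ 2 * g := by split_ifs at hh <;> omega
  have hh1 : 2 * g - 1 ≤ h := by split_ifs at hh <;> omega
  have hodd : ∀ i < m, ∀ j, 2 * j + 1 < h → ∃ b, (c i j).2 = some b := by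
    intro i hi j hj
    rcases Nat.lt_or_ge (j + 1) g with h1 | h1
    · exact hsome i hi j h1
    · obtain rfl : j = g - 1 := by omega
      rw [← Option.ne_none_iff_exists']
      intro h2
      rw [hsync i hi] at h2
      rw [if_pos h2] at hh
      omega
  set d : ℕ → ℕ → B := fun i j =>
    if j % 2 = 0 then (c i (j / 2)).1 else (c i (j / 2)).2.getD (c i (j / 2)).1 with hd
  have hd0 : ∀ i j, d i (2 * j) = (c i j).1 := fun i j => by
    simp [hd]
  have hd1 : ∀ i j b, (c i j).2 = some b → d i (2 * j + 1) = b := fun i j b hb => by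
    simp only [hd]
    rw [if_neg (by omega), show (2 * j + 1) / 2 = j by omega, hb]
    rfl
  refine ⟨h, d, by omega, fun j hj => ?_, fun i hi => ?_⟩
  · obtain ⟨k, rfl | rfl⟩ : ∃ k, j = 2 * k ∨ j = 2 * k + 1 := ⟨j / 2, by omega⟩
    · obtain ⟨h1, h2, h3⟩ := hr k (by omega)
      refine ⟨?_, fun i hi => ?_, ?_⟩
      all_goals beta_reduce
      · rw [hd0]; exact h1.1
      · rw [hd0, hd0]; exact (h2 i hi).1
      · rw [hd0]; exact h3.1
    · obtain ⟨h1, h2, h3⟩ := hr k (by omega)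
      refine ⟨?_, fun i hi => ?_, ?_⟩
      all_goals beta_reduce
      · obtain ⟨b, hb⟩ := hodd 0 hm k hj
        rw [hd1 _ _ _ hb]; exact h1.2 b hb
      · obtain ⟨b, hb⟩ := hodd i (by omega) k hj
        obtain ⟨b', hb'⟩ := hodd (i + 1) hi k hj
        rw [hd1 _ _ _ hb, hd1 _ _ _ hb']; exact (h2 i hi).2.2 b b' hb hb'
      · obtain ⟨b, hb⟩ := hodd (m - 1) (by omega) k hj
        rw [hd1 _ _ _ hb]; exact h3.2 b hb
  · obtain ⟨h1, h2, h3⟩ := hv i hi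
    have hin : ∀ j < g, ∀ b, (c i j).2 = some b → V (some (c i j).1) (some b) := by
      intro j hj b hb
      rcases j with _ | j
      · exact h1.2 b hb
      · exact (h2 j hj).2 b hb
    refine ⟨?_, fun j hj => ?_, ?_⟩
    all_goals beta_reduce
    · rw [show (0 : ℕ) = 2 * 0 by rfl, hd0]; exact h1.1
    · obtain ⟨k, rfl | rfl⟩ : ∃ k, j = 2 * k ∨ j = 2 * k + 1 := ⟨j / 2, by omega⟩
      · obtain ⟨b, hb⟩ := hodd i hi k hj
        rw [hd0, hd1 _ _ _ hb]
        exact hin k (by omega) b hb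
      · obtain ⟨b, hb, hb'⟩ := (h2 k (by omega)).1
        beta_reduce at hb hb'
        rw [hd1 _ _ _ hb, show 2 * k + 1 + 1 = 2 * (k + 1) by ring, hd0]
        exact hb'
    · change V (some ((c i (g - 1)).2.getD (c i (g - 1)).1)) none at h3
      cases hb : (c i (g - 1)).2 with
      | none =>
        have : h = 2 * g - 1 := by rw [hh, if_pos ((hsync i hi).1 hb)]
        rw [this, show 2 * g - 1 - 1 = 2 * (g - 1) by omega, hd0]
        rwa [hb] at h3
      | some b =>
        have : h = 2 * g := by
          rw [hh, if_neg]
          rw [← hsync i hi, hb]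
          simp
        rw [this, show 2 * g - 1 = 2 * (g - 1) + 1 by omega, hd1 _ _ _ hb]
        rwa [hb] at h3

theorem Realizes.pair {B : Type} {H V : Option B → Option B → Prop} {F : ℕ → ℕ}
    (hF : Realizes H V F) (hpos : ∀ m, 0 < F m) :
    Realizes (pairH H) (pairV V) fun m => (F m + 1) / 2 := by
  intro m g hm hg
  constructor
  · rintro ⟨c, hc⟩
    obtain ⟨h, d, rfl, hd⟩ := hc.unpair hm hg
    rw [(hF m h hm (by omega)).1 ⟨d, hd⟩]
  · rintro rfl
    obtain ⟨c, hc⟩ := (hF m (F m) hm (hpos m)).2 rfl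
    exact ⟨_, hc.pair (hpos m)⟩

/-! ### Pictures with a strictly increasing layer -/

/-- Pumping: rows `j` and `k` coincide, so deleting rows `j + 1, …, k` creates no new vertical pair.
-/
theorem IsPic.cut {B : Type} {H V : Option B → Option B → Prop} {m h : ℕ} {c : ℕ → ℕ → B}
    (hc : IsPic H V m h c) {j k : ℕ} (hjk : j < k) (hk : k < h) (heq : ∀ i < m, c i j = c i k) :
    IsPic H V m (h - (k - j)) fun i t => if t ≤ j then c i t else c i (t + (k - j)) := by
  obtain ⟨hr, hv⟩ := hc
  refine ⟨fun t ht => ?_, fun i hi => ?_⟩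
  · by_cases htj : t ≤ j
    · simpa only [if_pos htj] using hr t (by omega)
    · simpa only [if_neg htj] using hr (t + (k - j)) (by omega)
  · obtain ⟨h1, h2, h3⟩ := hv i hi
    refine ⟨?_, fun t ht => ?_, ?_⟩
    all_goals beta_reduce
    · rwa [if_pos (Nat.zero_le _)]
    · rcases lt_trichotomy t j with htj | rfl | htj
      · rw [if_pos (by omega), if_pos (by omega)]
        exact h2 t (by omega)
      · rw [if_pos le_rfl, if_neg (by omega), heq i hi, show t + 1 + (k - t) = k + 1 by omega]
        exact h2 k (by omega)
      · rw [if_neg (by omega), if_neg (by omega), show t + 1 + (k - j) = t + (k - j) + 1 by omega]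
        exact h2 (t + (k - j)) (by omega)
    · by_cases htj : h - (k - j) - 1 ≤ j
      · rw [if_pos htj, show h - (k - j) - 1 = j by omega, heq i hi, show k = h - 1 by omega]
        exact h3
      · rw [if_neg htj, show h - (k - j) - 1 + (k - j) = h - 1 by omega]
        exact h3

/-- A repeated row could be cut out, giving a second height for the same width; hence all rows are
distinct words of length `m`. The bound leaves room for a strictly increasing layer. -/
theorem Realizes.le_card_pow {B : Type} [Fintype B] {H V : Option B → Option B → Prop} {F : ℕ → ℕ}
    (hF : Realizes H V F) (hpos : ∀ m, 0 < F m) {m : ℕ} (hm : 0 < m) :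
    F m ≤ Fintype.card B ^ m := by
  classical
  obtain ⟨c, hc⟩ := (hF m (F m) hm (hpos m)).2 rfl
  have hinj : Function.Injective fun (j : Fin (F m)) (i : Fin m) => c i j := by
    have main : ∀ j k : Fin (F m), j < k → ¬ (fun i : Fin m => c i j) = fun i : Fin m => c i k := by
      intro j k hjk heq
      have h1 : (j : ℕ) < k := hjk
      have h2 := k.2
      have := (hF m (F m - (k - j)) hm (by omega)).1
        ⟨_, hc.cut hjk k.2 fun i hi => congrFun heq ⟨i, hi⟩⟩
      omega
    intro j k heq
    rcases lt_trichotomy j k with h | h | h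
    · exact absurd heq (main j k h)
    · exact h
    · exact absurd heq.symm (main k j h)
  simpa using Fintype.card_le_of_injective _ hinj

/-- `R` or the opposite relation. -/
def orient {B : Type} (R : Option B → Option B → Prop) (e : Bool) (a b : Option B) : Prop :=
  if e then R a b else R b a

/-- For every width, the number of successive admissible rows is bounded. -/
def Nilpotent {B : Type} (H V : Option B → Option B → Prop) : Prop :=
  ∀ (m : ℕ) (e : Bool), 0 < m → ∃ N : ℕ, ∀ w : ℕ → ℕ → B, (∀ j < N, LineOK H m fun i => w i j) →
    (∀ j, j + 1 < N → ∀ i < m, orient V e (w i j) (w i (j + 1))) → False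

/-- The transitions between neighbours in the sign pattern of `i ↦ i - k`. -/
def SignStep : Ordering → Ordering → Prop
  | .lt, .lt => True
  | .lt, .eq => True
  | .eq, .gt => True
  | .gt, .gt => True
  | _, _ => False

/-- Horizontal rule for pictures with a second layer and a layer of signs. -/
def lexH {B D : Type} (H : Option B → Option B → Prop) : Option (B × D × Ordering) →
    Option (B × D × Ordering) → Prop
  | none, none => True
  | none, some x => H none x.1 ∧ x.2.2 ≠ .gt
  | some x, none => H x.1 none ∧ x.2.2 ≠ .lt
  | some x, some y => H x.1 y.1 ∧ SignStep x.2.2 y.2.2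

/-- Vertical rule for pictures with a second layer whose rows increase lexicographically, the signs
marking the first difference with the row below. -/
def lexV {B D : Type} [LT D] (V : Option B → Option B → Prop) : Option (B × D × Ordering) →
    Option (B × D × Ordering) → Prop
  | none, none => True
  | none, some x => V none x.1
  | some x, none => V x.1 none
  | some x, some y => V x.1 y.1 ∧ (y.2.2 = .lt → x.2.1 = y.2.1) ∧ (y.2.2 = .eq → x.2.1 < y.2.1)

/-- The signs start in `.lt` or `.eq`, leave `.lt` only through `.eq`, and must have left it at the
end; the pivot is the first index that is not `.lt`. -/
theorem exists_pivot {s : ℕ → Ordering} {m : ℕ} (hm : 0 < m) (h0 : s 0 ≠ .gt)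
    (hstep : ∀ i, i + 1 < m → SignStep (s i) (s (i + 1))) (h1 : s (m - 1) ≠ .lt) :
    ∃ k < m, s k = .eq ∧ ∀ i < k, s i = .lt := by
  classical
  have hex : ∃ k, k < m ∧ s k ≠ .lt := ⟨m - 1, by omega, h1⟩
  have hmin : ∀ i < Nat.find hex, s i = .lt := fun i hi => by
    by_contra h
    exact Nat.find_min hex hi ⟨hi.trans (Nat.find_spec hex).1, h⟩
  obtain ⟨hk, hk'⟩ := Nat.find_spec hex
  refine ⟨Nat.find hex, hk, ?_, hmin⟩
  generalize Nat.find hex = k at *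
  rcases k with _ | k
  · cases h : s 0 <;> simp_all
  · have h2 := hstep k hk
    rw [hmin k (by omega)] at h2
    cases h : s (k + 1) <;> simp_all [SignStep]

theorem lexV_lt {B D : Type} [LinearOrder D] {H V : Option B → Option B → Prop} {m : ℕ}
    (hm : 0 < m) {u v : ℕ → B × D × Ordering} (hv : LineOK (lexH H) m v)
    (huv : ∀ i < m, lexV V (some (u i)) (some (v i))) :
    toLex (fun i : Fin m => (u i).2.1) < toLex (fun i : Fin m => (v i).2.1) := by
  obtain ⟨h1, h2, h3⟩ := hv
  obtain ⟨k, hk, hs, hlt⟩ := exists_pivot (s := fun i => (v i).2.2) hm h1.2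
    (fun i hi => (h2 i hi).2) h3.2
  exact ⟨⟨k, hk⟩, fun i hi => (huv i i.2).2.1 (hlt i hi), (huv k hk).2.2 hs⟩

/-- The second-layer words are strictly monotone in a finite linear order, upwards or downwards
according to `e`, so there cannot be more rows than words. -/
theorem nilpotent_lex {B D : Type} [LinearOrder D] [Finite D] (H V : Option B → Option B → Prop) :
    Nilpotent (lexH (D := D) H) (lexV V) := by
  classical
  have := Fintype.ofFinite D
  intro m e hm
  refine ⟨Fintype.card (Lex (Fin m → D)) + 1, fun w hw hv => ?_⟩
  set N := Fintype.card (Lex (Fin m → D)) + 1 with hN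
  let r : ℕ → Lex (Fin m → D) := fun j => toLex fun i => (w i j).2.1
  have hinj : Function.Injective fun j : Fin N => r j := by
    cases e
    · have hlt : ∀ j, j + 1 < N → r (j + 1) < r j := fun j hj =>
        lexV_lt hm (hw j (by omega)) (hv j hj)
      have : StrictAnti fun j : Fin N => r j :=
        Fin.strictAnti_iff_succ_lt.2 fun i => hlt i (by omega)
      exact this.injective
    · have hlt : ∀ j, j + 1 < N → r j < r (j + 1) := fun j hj =>
        lexV_lt hm (hw (j + 1) hj) (hv j hj)
      have : StrictMono fun j : Fin N => r j :=
        Fin.strictMono_iff_lt_succ.2 fun i => hlt i (by omega)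
      exact this.injective
  have := Fintype.card_le_of_injective _ hinj
  rw [Fintype.card_fin] at this
  omega

/-- Forgetting the new layers gives one direction. For the other, `hcard` provides at least as many
words over `D` as there are rows, and the rows receive the smallest words in order. -/
theorem Realizes.lex {B D : Type} [LinearOrder D] [Fintype D] {H V : Option B → Option B → Prop}
    {F : ℕ → ℕ} (hF : Realizes H V F)
    (hcard : ∀ m, 0 < m → F m ≤ Fintype.card D ^ m) :
    Realizes (lexH (D := D) H) (lexV V) F := by
  classical
  intro m h hm hh
  rw [← hF m h hm hh]
  constructor
  · rintro ⟨c, hr, hv⟩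
    exact ⟨fun i j => (c i j).1, fun j hj => ⟨(hr j hj).1.1, fun i hi => ((hr j hj).2.1 i hi).1,
      (hr j hj).2.2.1⟩, fun i hi => ⟨(hv i hi).1, fun j hj => ((hv i hi).2.1 j hj).1,
      (hv i hi).2.2⟩⟩
  · rintro ⟨c, hr, hv⟩
    have hle : h ≤ Fintype.card (Lex (Fin m → D)) := by
      rw [(hF m h hm hh).1 ⟨c, hr, hv⟩]
      simpa using hcard m hm
    let r : ℕ → Lex (Fin m → D) := fun j =>
      if hj : j < Fintype.card (Lex (Fin m → D)) then Fintype.orderIsoFinOfCardEq _ rfl ⟨j, hj⟩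
      else Fintype.orderIsoFinOfCardEq _ rfl ⟨0, by omega⟩
    have hlt : ∀ j, j + 1 < h → r j < r (j + 1) := by
      intro j hj
      simp only [r]
      rw [dif_pos (by omega), dif_pos (by omega)]
      exact (OrderIso.strictMono _) (Fin.mk_lt_mk.2 (Nat.lt_succ_self j))
    -- `k` is the first difference with the row below. The bottom row has none below it, and any
    -- pivot gives it an admissible sign pattern; `0` is taken.
    have hpiv : ∀ j, ∃ k < m, 0 < j → j < h →
        (∀ i (hi : i < m), i < k → ofLex (r (j - 1)) ⟨i, hi⟩ = ofLex (r j) ⟨i, hi⟩) ∧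
        ∀ hk : k < m, ofLex (r (j - 1)) ⟨k, hk⟩ < ofLex (r j) ⟨k, hk⟩ := by
      intro j
      by_cases hj : 0 < j ∧ j < h
      · have := hlt (j - 1) (by omega)
        rw [show j - 1 + 1 = j by omega] at this
        obtain ⟨k, h1, h2⟩ := this
        exact ⟨k, k.2, fun _ _ => ⟨fun i hi hik => h1 ⟨i, hi⟩ hik, fun _ => h2⟩⟩
      · exact ⟨0, hm, fun h1 h2 => absurd ⟨h1, h2⟩ hj⟩
    choose k hk hkr using hpiv
    refine ⟨fun i j => (c i j, ofLex (r j) ⟨min i (m - 1), by omega⟩, compare i (k j)), ?_, ?_⟩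
    · refine fun j hj => ⟨⟨(hr j hj).1, ?_⟩, fun i hi => ⟨(hr j hj).2.1 i hi, ?_⟩, (hr j hj).2.2, ?_⟩
      · simp [compare_gt_iff_gt]
      · dsimp only
        rcases lt_trichotomy (i + 1) (k j) with h1 | h1 | h1
        · rw [compare_lt_iff_lt.2 h1, compare_lt_iff_lt.2 (show i < k j by omega)]
          trivial
        · rw [compare_eq_iff_eq.2 h1, compare_lt_iff_lt.2 (show i < k j by omega)]
          trivial
        · rw [compare_gt_iff_gt.2 h1]
          rcases Nat.eq_or_lt_of_le (Nat.le_of_lt_succ h1) with h2 | h2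
          · rw [compare_eq_iff_eq.2 h2.symm]
            trivial
          · rw [compare_gt_iff_gt.2 h2]
            trivial
      · have := hk j
        simp only [ne_eq, compare_lt_iff_lt]
        omega
    · refine fun i hi => ⟨(hv i hi).1, fun j hj => ⟨(hv i hi).2.1 j hj, fun hs => ?_, fun hs => ?_⟩,
        (hv i hi).2.2⟩
      · have := (hkr (j + 1) (by omega) hj).1 i hi (compare_lt_iff_lt.1 hs)
        simp only [Nat.min_eq_left (show i ≤ m - 1 by omega)]
        exact this
      · have hik := compare_eq_iff_eq.1 hs
        have := (hkr (j + 1) (by omega) hj).2 (hk _)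
        simp only [Nat.min_eq_left (show i ≤ m - 1 by omega)]
        simp only [← hik] at this
        exact this

/-! ### Subshifts with local rules -/

/-- The forbidden patterns are those on the window `D` none of whose extensions satisfies `P`; there
are finitely many. -/
theorem isSFT_of_local {A : Type} [Finite A] (D : Finset (ℤ × ℤ)) (P : Config A → Prop)
    (hP : ∀ z z' : Config A, (∀ d ∈ D, z d = z' d) → P z → P z') :
    IsSFT {x | ∀ v, P (shift v x)} := by
  refine ⟨Sigma.mk D '' {p : Pattern A D | ∀ z ∈ cylinder p, ¬ P z},
    (Set.toFinite _).image _, Set.ext fun x => ⟨fun hx v p hp hmem => ?_, fun hx v => ?_⟩⟩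
  · obtain ⟨q, hq, rfl⟩ := hp
    exact hq _ hmem (hx v)
  · by_contra hv
    refine hx v ⟨D, fun d => shift v x d⟩ ⟨_, fun z hz hPz => hv ?_, rfl⟩ fun d => rfl
    exact hP z _ (fun d hd => hz ⟨d, hd⟩) hPz

theorem mem_square {n : ℕ} {v : ℤ × ℤ} :
    v ∈ square n ↔ (0 ≤ v.1 ∧ v.1 < n) ∧ 0 ≤ v.2 ∧ v.2 < n := by
  simp [square]

theorem gluesAt_iff {A : Type} {X : Set (Config A)} {n : ℕ} {v : ℤ × ℤ} :
    GluesAt X n v ↔ ∀ x ∈ X, ∀ y ∈ X, ∃ z ∈ X,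
      (∀ u ∈ square n, z u = x u) ∧ ∀ u ∈ square n, z (u + v) = y u := by
  constructor
  · intro h x hx y hy
    obtain ⟨z, ⟨hz, hzp⟩, z', hz', rfl⟩ := h (fun u => x u) ⟨x, hx, fun _ => rfl⟩ (fun u => y u)
      ⟨y, hy, fun _ => rfl⟩
    refine ⟨_, hz, fun u hu => hzp ⟨u, hu⟩, fun u hu => ?_⟩
    rw [shift, add_neg_cancel_right]
    exact hz' ⟨u, hu⟩
  · rintro h p ⟨x, hx, hxp⟩ q ⟨y, hy, hyq⟩
    obtain ⟨z, hz, h1, h2⟩ := h x hx y hy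
    refine ⟨z, ⟨hz, fun u => (h1 u u.2).trans (hxp u)⟩, shift v z,
      fun u => (h2 u u.2).trans (hyq u), funext fun u => ?_⟩
    simp [shift]

/-! ### The shift of floating pictures -/

/-- The unit step in a direction (`true` for right or up, `false` for left or down). -/
def dir (s : Bool) : ℤ := if s then 1 else -1

@[simp] theorem dir_true : dir true = 1 := rfl

@[simp] theorem dir_false : dir false = -1 := rfl

/-- The flags telling whether `t` is the first (`false`) or last (`true`) element of
`{0, …, m - 1}`. -/
def endFlags (t m : ℕ) : Bool → Bool := fun s => if s then decide (t + 1 = m) else decide (t = 0)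

@[simp] theorem endFlags_true (t m : ℕ) : endFlags t m true = decide (t + 1 = m) := rfl

@[simp] theorem endFlags_false (t m : ℕ) : endFlags t m false = decide (t = 0) := rfl

/-- A picture cell; `side` marks the left and right ends, `cap` the bottom and top rows. -/
structure Cell (B : Type) where
  val : B
  side : Bool → Bool
  cap : Bool → Bool

instance {B : Type} [Finite B] : Finite (Cell B) :=
  Finite.of_injective (fun c : Cell B => (c.val, c.side, c.cap)) fun c d h => by
    cases c
    cases d
    simp_all

variable {B : Type} {H V : Option B → Option B → Prop}

/-- The rule for a picture cell `c` at `(i, j)`. A blank `inl s` next to a cell that is not capped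
there announces that the row of that cell has no marked end in direction `s`. -/
structure ValidAt (H V : Option B → Option B → Prop) (x : Config (Bool ⊕ Cell B)) (i j : ℤ)
    (c : Cell B) : Prop where
  side_end : ∀ s, c.side s = true → orient H s (some c.val) none
  side_next : ∀ s, c.side s = false → ∀ c', x (i + dir s, j) = .inr c' →
    c'.side (!s) = false ∧ c'.cap = c.cap ∧ orient H s (some c.val) (some c'.val)
  cap_end : ∀ e, c.cap e = true → orient V e (some c.val) none
  cap_next : ∀ e, c.cap e = false → ∀ c', x (i, j + dir e) = .inr c' →
    c'.cap (!e) = false ∧ c'.side = c.side ∧ orient V e (some c.val) (some c'.val)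
  blank : ∀ e s, c.cap e = false → x (i, j + dir e) = .inl s →
    c.side s = false ∧ ∀ c', x (i + dir s, j) = .inr c' → x (i + dir s, j + dir e) = .inl s

/-- The configurations of floating pictures. -/
def pictureShift (H V : Option B → Option B → Prop) : Set (Config (Bool ⊕ Cell B)) :=
  {x | ∀ i j c, x (i, j) = .inr c → ValidAt H V x i j c}

theorem ValidAt.congr {x x' : Config (Bool ⊕ Cell B)} {i j i' j' : ℤ} {c : Cell B}
    (h : ∀ a b, |a| ≤ 1 → |b| ≤ 1 → x (i + a, j + b) = x' (i' + a, j' + b))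
    (hx : ValidAt H V x i j c) : ValidAt H V x' i' j' c := by
  have hd : ∀ s, |dir s| ≤ 1 := fun s => by cases s <;> simp
  have h1 : ∀ s, x' (i' + dir s, j') = x (i + dir s, j) := fun s => by
    simpa using (h (dir s) 0 (hd s) (by simp)).symm
  have h2 : ∀ s, x' (i', j' + dir s) = x (i, j + dir s) := fun s => by
    simpa using (h 0 (dir s) (by simp) (hd s)).symm
  have h3 : ∀ s e, x' (i' + dir s, j' + dir e) = x (i + dir s, j + dir e) := fun s e =>
    (h (dir s) (dir e) (hd s) (hd e)).symm
  refine ⟨hx.side_end, ?_, hx.cap_end, ?_, ?_⟩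
  · simpa only [h1] using hx.side_next
  · simpa only [h2] using hx.cap_next
  · simpa only [h1, h2, h3] using hx.blank

theorem blank_mem_pictureShift : (fun _ => .inl false) ∈ pictureShift H V := by
  intro i j c hc
  cases hc

theorem translate_mem_pictureShift {x : Config (Bool ⊕ Cell B)} (hx : x ∈ pictureShift H V)
    (a b : ℤ) : (fun u : ℤ × ℤ => x (u.1 + a, u.2 + b)) ∈ pictureShift H V := by
  intro i j c hc
  refine (hx _ _ c hc).congr fun a' b' _ _ => ?_
  dsimp only
  congr 2 <;> ring

/-- Points of one `3 × 3` window differ by at most `2` in each coordinate, so no window meets both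
`S` and `S'`. As both backgrounds are the same blank, each window is copied from `y` or from `y'`.
-/
theorem exists_glue {y y' : Config (Bool ⊕ Cell B)} (hy : y ∈ pictureShift H V)
    (hy' : y' ∈ pictureShift H V) {S S' : Set (ℤ × ℤ)} (hS : ∀ v ∉ S, y v = .inl false)
    (hS' : ∀ v ∉ S', y' v = .inl false)
    (hfar : ∀ v ∈ S, ∀ v' ∈ S', |v.1 - v'.1| ≤ 2 → |v.2 - v'.2| ≤ 2 → False) :
    ∃ z ∈ pictureShift H V, (∀ v ∈ S, z v = y v) ∧ ∀ v ∈ S', z v = y' v := by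
  classical
  let z : Config (Bool ⊕ Cell B) := fun v => if v ∈ S then y v else y' v
  have hz' : ∀ v ∉ S, z v = y' v := fun v hv => if_neg hv
  have hz : ∀ v ∉ S', z v = y v := fun v hv => by
    by_cases h : v ∈ S
    · exact if_pos h
    · rw [hz' v h, hS v h, hS' v hv]
  refine ⟨z, fun i j c hc => ?_, fun v hv => if_pos hv, fun v hv => hz' v fun h =>
    hfar v h v hv (by simp) (by simp)⟩
  by_cases hcase : ∃ a b : ℤ, |a| ≤ 1 ∧ |b| ≤ 1 ∧ (i + a, j + b) ∈ S
  · obtain ⟨a, b, ha, hb, hab⟩ := hcase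
    have hw : ∀ a' b' : ℤ, |a'| ≤ 1 → |b'| ≤ 1 → y (i + a', j + b') = z (i + a', j + b') := by
      refine fun a' b' ha' hb' => (hz _ fun hmem => hfar _ hab _ hmem ?_ ?_).symm <;>
      · simp only [abs_le] at *
        constructor <;> linarith
    have h0 := hw 0 0 (by simp) (by simp)
    simp only [add_zero] at h0
    exact (hy i j c (h0.trans hc)).congr hw
  · push Not at hcase
    have hw : ∀ a' b' : ℤ, |a'| ≤ 1 → |b'| ≤ 1 → y' (i + a', j + b') = z (i + a', j + b') :=
      fun a' b' ha' hb' => (hz' _ (hcase a' b' ha' hb')).symm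
    have h0 := hw 0 0 (by simp) (by simp)
    simp only [add_zero] at h0
    exact (hy' i j c (h0.trans hc)).congr hw

/-! ### Rows with both ends marked -/

/-- A sequence of flags that can be continued in each direction up to an end flag, and not forever,
contains an interval delimited by end flags. -/
theorem exists_interval {Φ : ℤ → (Bool → Bool) → Prop}
    (huniq : ∀ i κ κ', Φ i κ → Φ i κ' → κ = κ')
    (hstep : ∀ i κ s, Φ i κ → κ s = false → ∃ κ', Φ (i + dir s) κ' ∧ κ' (!s) = false)
    (hfin : ∀ i s, ¬ ∀ t : ℕ, ∃ κ, Φ (i + dir s * t) κ ∧ κ s = false) {i : ℤ} {κ : Bool → Bool}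
    (hi : Φ i κ) :
    ∃ (a : ℤ) (m : ℕ), a ≤ i ∧ i < a + m ∧ ∀ q < m, Φ (a + q) (endFlags q m) := by
  classical
  have hreach : ∀ s, ∃ d : ℕ, ∀ t : ℕ, t ≤ d →
      ∃ κ, Φ (i + dir s * t) κ ∧ κ s = decide (t = d) ∧ (0 < t → κ (!s) = false) := by
    intro s
    have hstep' : ∀ t : ℕ, (t = 0 ∨ ∃ κ, Φ (i + dir s * (t - 1 : ℕ)) κ ∧ κ s = false) →
        ∃ κ, Φ (i + dir s * t) κ ∧ (0 < t → κ (!s) = false) := by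
      rintro (_ | t) ht
      · exact ⟨κ, by simpa using hi, by simp⟩
      · obtain ⟨κ, h1, h2⟩ := ht.resolve_left (by omega)
        obtain ⟨κ', h3, h4⟩ := hstep _ _ s h1 h2
        refine ⟨κ', ?_, fun _ => h4⟩
        convert h3 using 1
        push_cast
        ring
    have hex : ∃ t : ℕ, ¬ ∃ κ, Φ (i + dir s * t) κ ∧ κ s = false := by
      simpa only [not_forall] using hfin i s
    have hmin : ∀ t < Nat.find hex, ∃ κ, Φ (i + dir s * t) κ ∧ κ s = false := fun t ht =>
      not_not.1 (Nat.find_min hex ht)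
    have hspec := Nat.find_spec hex
    -- `d` is the distance from `i` to the first marked end in direction `s`.
    generalize Nat.find hex = d at hmin hspec
    refine ⟨d, fun t ht => ?_⟩
    obtain ⟨κ, h1, h2⟩ := hstep' t (or_iff_not_imp_left.2 fun h0 => hmin _ (by omega))
    refine ⟨κ, h1, ?_, h2⟩
    rcases Nat.lt_or_ge t d with h3 | h3
    · obtain ⟨κ', h4, h5⟩ := hmin t h3
      rw [huniq _ _ _ h1 h4, h5, decide_eq_false (by omega)]
    · obtain rfl : t = d := by omega
      rw [decide_eq_true rfl]
      by_contra h4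
      exact hspec ⟨κ, h1, by simpa using h4⟩
  obtain ⟨d, hd⟩ := hreach false
  obtain ⟨d', hd'⟩ := hreach true
  refine ⟨i - d, d + d' + 1, by omega, by push_cast; omega, fun q hq => ?_⟩
  rcases Nat.lt_trichotomy q d with h | h | h
  · obtain ⟨κ, h1, h2, h3⟩ := hd (d - q) (by omega)
    have h3 := h3 (by omega)
    have : endFlags q (d + d' + 1) = κ := by
      funext s
      cases s
      · rw [h2, endFlags_false]
        exact decide_eq_decide.2 (by omega)
      · rw [Bool.not_false] at h3
        rw [h3, endFlags_true]
        exact decide_eq_false (by omega)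
    rw [this]
    convert h1 using 1
    push_cast [h.le]
    simp
    ring
  · subst h
    obtain ⟨κ, h1, h2, -⟩ := hd 0 (by omega)
    obtain ⟨κ', h1', h2', -⟩ := hd' 0 (by omega)
    simp only [Nat.cast_zero, mul_zero, add_zero] at h1 h1'
    obtain rfl := huniq _ _ _ h1 h1'
    have : endFlags q (q + d' + 1) = κ := by
      funext s
      cases s
      · rw [h2, endFlags_false]
        exact decide_eq_decide.2 (by omega)
      · rw [h2', endFlags_true]
        exact decide_eq_decide.2 (by omega)
    rw [this, sub_add_cancel]
    exact h1
  · obtain ⟨κ, h1, h2, h3⟩ := hd' (q - d) (by omega)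
    have h3 := h3 (by omega)
    have : endFlags q (d + d' + 1) = κ := by
      funext s
      cases s
      · rw [Bool.not_true] at h3
        rw [h3, endFlags_false]
        exact decide_eq_false (by omega)
      · rw [h2, endFlags_true]
        exact decide_eq_decide.2 (by omega)
    rw [this]
    convert h1 using 1
    push_cast [h.le]
    simp
    ring

/-- A row of picture cells with both ends marked, all with the same cap flags. -/
def IsRow (x : Config (Bool ⊕ Cell B)) (a : ℤ) (m : ℕ) (j : ℤ) (κ : Bool → Bool) : Prop :=
  ∀ i < m, ∃ c, x (a + (i : ℕ), j) = .inr c ∧ c.side = endFlags i m ∧ c.cap = κ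

/-- A complete picture. -/
def IsBlock (x : Config (Bool ⊕ Cell B)) (a b : ℤ) (m h : ℕ) : Prop :=
  ∀ q < h, IsRow x a m (b + (q : ℕ)) (endFlags q h)

theorem IsRow.unique {x : Config (Bool ⊕ Cell B)} {a j : ℤ} {m : ℕ} {κ κ' : Bool → Bool}
    (hm : 0 < m) (h : IsRow x a m j κ) (h' : IsRow x a m j κ') : κ = κ' := by
  obtain ⟨c, h1, -, h2⟩ := h 0 hm
  obtain ⟨c', h1', -, h2'⟩ := h' 0 hm
  rw [h1] at h1'
  cases h1'
  rw [← h2, ← h2']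

theorem exists_isRow {x : Config (Bool ⊕ Cell B)} (hx : x ∈ pictureShift H V) {a j : ℤ} {m : ℕ}
    (h : ∀ i < m, ∃ c, x (a + (i : ℕ), j) = .inr c ∧ c.side = endFlags i m) :
    ∃ κ, IsRow x a m j κ := by
  rcases Nat.eq_zero_or_pos m with rfl | hm
  · exact ⟨fun _ => false, fun i hi => absurd hi (by omega)⟩
  obtain ⟨c, hc, -⟩ := h 0 hm
  refine ⟨c.cap, fun i => ?_⟩
  induction i with
  | zero =>
    intro _
    obtain ⟨c', hc', h2⟩ := h 0 hm
    rw [hc] at hc'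
    cases hc'
    exact ⟨c, hc, h2, rfl⟩
  | succ i ih =>
    intro hi
    obtain ⟨d, h1, h2, h3⟩ := ih (by omega)
    obtain ⟨d', h1', h2'⟩ := h (i + 1) hi
    refine ⟨d', h1', h2', ?_⟩
    rw [← h3]
    refine ((hx _ _ d h1).side_next true ?_ d' ?_).2.1
    · rw [h2, endFlags_true]
      exact decide_eq_false (by omega)
    · rw [← h1', dir_true]
      push_cast
      rw [add_assoc]

/-- A blank `inl s` beside an uncapped complete row would spread in direction `s` along the row to
its marked end, where the `blank` rule forbids it. The induction in `hblank` is on the distance `k`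
to that end. -/
theorem IsRow.next {x : Config (Bool ⊕ Cell B)} (hx : x ∈ pictureShift H V) {a j : ℤ} {m : ℕ}
    {κ : Bool → Bool} (h : IsRow x a m j κ) {e : Bool} (he : κ e = false) :
    ∃ κ', IsRow x a m (j + dir e) κ' ∧ (0 < m → κ' (!e) = false) := by
  have hblank : ∀ (s : Bool) (k i : ℕ), i < m →
      (if s then i + k + 1 = m else i = k) → x (a + (i : ℕ), j + dir e) ≠ .inl s := by
    intro s k
    induction k with
    | zero =>
      intro i hi hk hs
      obtain ⟨c, h1, h2, h3⟩ := h i hi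
      have := ((hx _ _ c h1).blank e s (by rw [h3, he]) hs).1
      rw [h2] at this
      cases s <;> simp at this hk <;> omega
    | succ k ih =>
      intro i hi hk hs
      obtain ⟨c, h1, h2, h3⟩ := h i hi
      have hnext := ((hx _ _ c h1).blank e s (by rw [h3, he]) hs).2
      cases s
      · simp only [Bool.false_eq_true, if_false] at hk ih
        obtain ⟨c', h1', -⟩ := h (i - 1) (by omega)
        have hpos : a + (i : ℤ) + dir false = a + ((i - 1 : ℕ) : ℤ) := by
          rw [dir_false]
          omega
        rw [hpos] at hnext
        exact ih (i - 1) (by omega) (by omega) (hnext c' h1')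
      · simp only [if_true] at hk ih
        obtain ⟨c', h1', -⟩ := h (i + 1) (by omega)
        have hpos : a + (i : ℤ) + dir true = a + ((i + 1 : ℕ) : ℤ) := by
          rw [dir_true]
          omega
        rw [hpos] at hnext
        exact ih (i + 1) (by omega) (by omega) (hnext c' h1')
  have hcell : ∀ i < m, ∃ c, x (a + (i : ℕ), j + dir e) = .inr c ∧ c.side = endFlags i m ∧
      c.cap (!e) = false := by
    intro i hi
    obtain ⟨c, h1, h2, h3⟩ := h i hi
    cases hc : x (a + (i : ℕ), j + dir e) with
    | inl s =>
      cases s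
      · exact absurd hc (hblank false i i hi (by simp))
      · exact absurd hc (hblank true (m - 1 - i) i hi (by rw [if_pos rfl]; omega))
    | inr c' =>
      obtain ⟨h4, h5, -⟩ := (hx _ _ c h1).cap_next e (by rw [h3, he]) c' hc
      exact ⟨c', rfl, h5.trans h2, h4⟩
  obtain ⟨κ', hκ'⟩ := exists_isRow hx fun i hi =>
    let ⟨c, h1, h2, _⟩ := hcell i hi
    ⟨c, h1, h2⟩
  refine ⟨κ', hκ', fun hm => ?_⟩
  obtain ⟨c, h1, -, h2⟩ := hκ' 0 hm
  obtain ⟨c', h1', -, h2'⟩ := hcell 0 hm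
  rw [h1] at h1'
  cases h1'
  rw [← h2, h2']

/-- The letter at `v`, with default value `b₀`. -/
def valAt (b₀ : B) (x : Config (Bool ⊕ Cell B)) (v : ℤ × ℤ) : B := (x v).elim (fun _ => b₀) Cell.val

theorem valAt_eq {b₀ : B} {x : Config (Bool ⊕ Cell B)} {v : ℤ × ℤ} {c : Cell B}
    (h : x v = .inr c) : valAt b₀ x v = c.val := by
  rw [valAt, h]
  rfl

theorem IsRow.lineOK {x : Config (Bool ⊕ Cell B)} (hx : x ∈ pictureShift H V) {a j : ℤ} {m : ℕ}
    {κ : Bool → Bool} (hm : 0 < m) (h : IsRow x a m j κ) (b₀ : B) :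
    LineOK H m fun i => valAt b₀ x (a + (i : ℕ), j) := by
  refine ⟨?_, fun i hi => ?_, ?_⟩
  · obtain ⟨c, h1, h2, -⟩ := h 0 hm
    beta_reduce
    rw [valAt_eq h1]
    exact (hx _ _ c h1).side_end false (by rw [h2]; simp)
  · obtain ⟨c, h1, h2, -⟩ := h i (by omega)
    obtain ⟨c', h1', -⟩ := h (i + 1) hi
    beta_reduce
    rw [valAt_eq h1, valAt_eq h1']
    refine ((hx _ _ c h1).side_next true ?_ c' ?_).2.2
    · rw [h2, endFlags_true]
      exact decide_eq_false (by omega)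
    · rw [← h1', dir_true]
      push_cast
      rw [add_assoc]
  · obtain ⟨c, h1, h2, -⟩ := h (m - 1) (by omega)
    beta_reduce
    rw [valAt_eq h1]
    refine (hx _ _ c h1).side_end true ?_
    rw [h2, endFlags_true]
    exact decide_eq_true (by omega)

theorem IsRow.orient_next {x : Config (Bool ⊕ Cell B)} (hx : x ∈ pictureShift H V) {a j : ℤ}
    {m : ℕ} {κ κ' : Bool → Bool} (h : IsRow x a m j κ) {e : Bool} (he : κ e = false)
    (h' : IsRow x a m (j + dir e) κ') (b₀ : B) {i : ℕ} (hi : i < m) :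
    orient V e (some (valAt b₀ x (a + (i : ℕ), j))) (some (valAt b₀ x (a + (i : ℕ), j + dir e))) := by
  obtain ⟨c, h1, -, h3⟩ := h i hi
  obtain ⟨c', h1', -⟩ := h' i hi
  rw [valAt_eq h1, valAt_eq h1']
  exact ((hx _ _ c h1).cap_next e (by rw [h3, he]) c' h1').2.2

/-- `exists_interval` in the vertical direction: `IsRow.next` continues the stack past an uncapped
row, and `Nilpotent` excludes an infinite stack. -/
theorem IsRow.exists_isBlock {x : Config (Bool ⊕ Cell B)} (hx : x ∈ pictureShift H V)
    (hnil : Nilpotent H V) {a j : ℤ} {m : ℕ} {κ : Bool → Bool} (hm : 0 < m)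
    (h : IsRow x a m j κ) : ∃ (b : ℤ) (k : ℕ), b ≤ j ∧ j < b + k ∧ IsBlock x a b m k := by
  refine exists_interval (Φ := fun j κ => IsRow x a m j κ) (fun _ _ _ h h' => h.unique hm h')
    (fun i κ s hκ hs => ?_) (fun i s hinf => ?_) h
  · obtain ⟨κ', h1, h2⟩ := hκ.next hx hs
    exact ⟨κ', h1, h2 hm⟩
  · obtain ⟨c₀, -⟩ := h 0 hm
    obtain ⟨N, hN⟩ := hnil m s hm
    refine hN (fun p t => valAt c₀.val x (a + (p : ℕ), i + dir s * (t : ℕ))) (fun t _ => ?_)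
      fun t _ p hp => ?_
    · obtain ⟨κ, h1, -⟩ := hinf t
      exact h1.lineOK hx hm c₀.val
    · obtain ⟨κ, h1, h2⟩ := hinf t
      obtain ⟨κ', h1', -⟩ := hinf (t + 1)
      have hpos : i + dir s * ((t + 1 : ℕ) : ℤ) = i + dir s * (t : ℤ) + dir s := by
        push_cast
        ring
      rw [hpos] at h1' ⊢
      exact h1.orient_next hx h2 h1' c₀.val hp

theorem IsBlock.height_eq {x : Config (Bool ⊕ Cell B)} (hx : x ∈ pictureShift H V) {G : ℕ → ℕ}
    (hG : Realizes H V G) {a b : ℤ} {m h : ℕ} (hm : 0 < m) (hh : 0 < h)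
    (hb : IsBlock x a b m h) : h = G m := by
  obtain ⟨c₀, -⟩ := hb 0 hh 0 hm
  rw [← hG m h hm hh]
  refine ⟨fun i j => valAt c₀.val x (a + (i : ℕ), b + (j : ℕ)), fun j hj =>
    (hb j hj).lineOK hx hm c₀.val, fun i hi => ⟨?_, fun j hj => ?_, ?_⟩⟩
  · obtain ⟨c, h1, -, h3⟩ := hb 0 hh i hi
    beta_reduce
    rw [valAt_eq h1]
    exact (hx _ _ c h1).cap_end false (by rw [h3]; simp)
  · have := (hb j (by omega)).orient_next hx (e := true) (κ' := endFlags (j + 1) h)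
      (decide_eq_false (by omega)) (by simpa [add_assoc] using hb (j + 1) hj) c₀.val hi
    simpa [add_assoc, orient] using this
  · obtain ⟨c, h1, -, h3⟩ := hb (h - 1) (by omega) i hi
    beta_reduce
    rw [valAt_eq h1]
    refine (hx _ _ c h1).cap_end true ?_
    rw [h3, endFlags_true]
    exact decide_eq_true (by omega)

/-! ### Completing a square pattern -/

/-- Going from column `i` in direction `s`, the row `j` of the part of `x` in columns
`0, …, n - 1` has no marked end. -/
inductive BadEnd (x : Config (Bool ⊕ Cell B)) (n : ℕ) (s : Bool) (j : ℤ) : ℤ → Prop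
  | halt (i : ℤ) (c : Cell B) (h0 : 0 ≤ i) (hn : i < n) (hc : x (i, j) = .inr c)
      (hs : c.side s = false)
      (hnone : ∀ c', 0 ≤ i + dir s → i + dir s < n → x (i + dir s, j) ≠ .inr c') :
      BadEnd x n s j i
  | step (i : ℤ) (c : Cell B) (h0 : 0 ≤ i) (hn : i < n) (hc : x (i, j) = .inr c)
      (hs : c.side s = false) (hstep : BadEnd x n s j (i + dir s)) : BadEnd x n s j i

variable {x : Config (Bool ⊕ Cell B)} {n : ℕ} {s : Bool} {i j : ℤ}

theorem BadEnd.side_eq_false (h : BadEnd x n s j i) {c : Cell B} (hc : x (i, j) = .inr c) :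
    c.side s = false := by
  cases h with
  | halt _ c' _ _ hc' hs _ =>
    rw [hc] at hc'
    cases hc'
    exact hs
  | step _ c' _ _ hc' hs _ =>
    rw [hc] at hc'
    cases hc'
    exact hs

theorem BadEnd.next (h : BadEnd x n s j i) {c' : Cell B} (h0 : 0 ≤ i + dir s)
    (hn : i + dir s < n) (hc' : x (i + dir s, j) = .inr c') : BadEnd x n s j (i + dir s) := by
  cases h with
  | halt _ _ _ _ _ _ hnone => exact absurd hc' (hnone c' h0 hn)
  | step _ _ _ _ _ _ hstep => exact hstep

/-- In a complete row, a cell with no end mark in direction `s` has its neighbour on that side in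
the same row, so the walk witnessing `BadEnd` could never halt. -/
theorem BadEnd.not_isRow {a : ℤ} {m : ℕ} {κ : Bool → Bool} (h : BadEnd x n s j i) (ha : 0 ≤ a)
    (hm : a + m ≤ n) (hrow : IsRow x a m j κ) : ¬ (a ≤ i ∧ i < a + m) := by
  have key : ∀ i c, x (i, j) = .inr c → c.side s = false → a ≤ i → i < a + m →
      a ≤ i + dir s ∧ i + dir s < a + m := by
    intro i c hc hs h1 h2
    obtain ⟨q, rfl⟩ : ∃ q : ℕ, i = a + q := ⟨(i - a).toNat, by omega⟩
    obtain ⟨c', hc', hside, -⟩ := hrow q (by omega)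
    rw [hc] at hc'
    cases hc'
    rw [hside] at hs
    cases s <;> simp at hs ⊢ <;> omega
  induction h with
  | halt i c h0 hn hc hs hnone =>
    rintro ⟨h1, h2⟩
    obtain ⟨h3, h4⟩ := key i c hc hs h1 h2
    obtain ⟨c', hc', -⟩ := hrow (i + dir s - a).toNat (by omega)
    rw [show a + ((i + dir s - a).toNat : ℤ) = i + dir s by omega] at hc'
    exact hnone c' (by omega) (by omega) hc'
  | step i c h0 hn hc hs hstep ih =>
    rintro ⟨h1, h2⟩
    exact ih (key i c hc hs h1 h2)

/-- `exists_interval` along the row: where no end is marked there is a next cell, and its ends are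
not bad either, since badness in both directions would pass back to the current cell. The walk stops
because there are `n` columns. -/
theorem exists_isRow_of_not_badEnd (hx : x ∈ pictureShift H V) {c : Cell B} (h0 : 0 ≤ i)
    (hn : i < n) (hc : x (i, j) = .inr c) (hbad : ∀ s, ¬ BadEnd x n s j i) :
    ∃ (a : ℤ) (m : ℕ) (κ : Bool → Bool), 0 ≤ a ∧ a + m ≤ n ∧ a ≤ i ∧ i < a + m ∧
      IsRow x a m j κ := by
  let Φ : ℤ → (Bool → Bool) → Prop := fun i κ => (0 ≤ i ∧ i < n) ∧
    (∃ c, x (i, j) = .inr c ∧ c.side = κ) ∧ ∀ s, ¬ BadEnd x n s j i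
  have key : ∃ (a : ℤ) (m : ℕ), a ≤ i ∧ i < a + m ∧ ∀ q < m, Φ (a + q) (endFlags q m) := by
    refine exists_interval ?_ ?_ ?_ (κ := c.side) ⟨⟨h0, hn⟩, ⟨c, hc, rfl⟩, hbad⟩
    · rintro i κ κ' ⟨-, ⟨c, hc, rfl⟩, -⟩ ⟨-, ⟨c', hc', rfl⟩, -⟩
      rw [hc] at hc'
      cases hc'
      rfl
    · rintro i κ s ⟨⟨h0, hn⟩, ⟨c, hc, rfl⟩, hbad⟩ hs
      have hnext : ∃ c', (0 ≤ i + dir s ∧ i + dir s < n) ∧ x (i + dir s, j) = .inr c' := by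
        by_contra hcon
        push Not at hcon
        exact hbad s (.halt i c h0 hn hc hs fun c' h1 h2 => hcon c' ⟨h1, h2⟩)
      obtain ⟨c', hrange, hc'⟩ := hnext
      refine ⟨c'.side, ⟨hrange, ⟨c', hc', rfl⟩, fun s' hb => ?_⟩,
        ((hx _ _ c hc).side_next s hs c' hc').1⟩
      rcases Bool.eq_or_eq_not s' s with rfl | rfl
      · exact hbad _ (.step i c h0 hn hc hs hb)
      · have hpos : i + dir s + dir (!s) = i := by cases s <;> simp
        have := hb.next (c' := c) (by omega) (by omega) (by rw [hpos]; exact hc)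
        rw [hpos] at this
        exact hbad _ this
    · intro i s hinf
      obtain ⟨-, ⟨⟨h1, h2⟩, -⟩, -⟩ := hinf 0
      obtain ⟨-, ⟨⟨h3, h4⟩, -⟩, -⟩ := hinf n
      cases s <;> simp at h1 h2 h3 h4 <;> omega
  obtain ⟨a, m, h1, h2, h3⟩ := key
  obtain ⟨κ, hκ⟩ := exists_isRow hx fun q hq => (h3 q hq).2.1
  have h4 := (h3 0 (by omega)).1
  have h5 := (h3 (m - 1) (by omega)).1
  exact ⟨a, m, κ, by omega, by omega, h1, h2, hκ⟩

/-- The position `v` belongs to a complete picture of `x` that lies in the columns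
`0, …, n - 1` and meets the rows `0, …, n - 1`. -/
def Kept (x : Config (Bool ⊕ Cell B)) (n : ℕ) (v : ℤ × ℤ) : Prop :=
  ∃ (a b : ℤ) (m h : ℕ), 0 ≤ a ∧ a + m ≤ n ∧ b < n ∧ 0 < b + h ∧ (a ≤ v.1 ∧ v.1 < a + m) ∧
    (b ≤ v.2 ∧ v.2 < b + h) ∧ IsBlock x a b m h

open Classical in
/-- The restriction of `x` to the square, completed by the pictures that must be completed. -/
noncomputable def patch (x : Config (Bool ⊕ Cell B)) (n : ℕ) : Config (Bool ⊕ Cell B) := fun v =>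
  if v ∈ square n ∨ Kept x n v then x v
  else .inl (decide ((v.2 = n ∧ BadEnd x n true (n - 1) v.1) ∨
    (v.2 = -1 ∧ BadEnd x n true 0 v.1)))

theorem patch_of_mem_square {v : ℤ × ℤ} (h : v ∈ square n) : patch x n v = x v :=
  if_pos (.inl h)

theorem patch_of_kept {v : ℤ × ℤ} (h : Kept x n v) : patch x n v = x v :=
  if_pos (.inr h)

theorem patch_eq_inr {v : ℤ × ℤ} {c : Cell B} (h : patch x n v = .inr c) :
    x v = .inr c ∧ (v ∈ square n ∨ Kept x n v) := by
  rw [patch] at h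
  split_ifs at h with h1
  exact ⟨h, h1⟩

theorem Kept.exists_cell {v : ℤ × ℤ} (h : Kept x n v) : ∃ c, x v = .inr c := by
  obtain ⟨a, b, m, k, -, -, -, -, h1, h2, h3⟩ := h
  obtain ⟨c, hc, -⟩ := h3 (v.2 - b).toNat (by omega) (v.1 - a).toNat (by omega)
  rw [show a + ((v.1 - a).toNat : ℤ) = v.1 by omega,
    show b + ((v.2 - b).toNat : ℤ) = v.2 by omega] at hc
  exact ⟨c, hc⟩

theorem BadEnd.bounds (h : BadEnd x n s j i) : 0 ≤ i ∧ i < n := by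
  cases h <;> constructor <;> assumption

theorem column_bounds {v : ℤ × ℤ} (h : v ∈ square n ∨ Kept x n v) : 0 ≤ v.1 ∧ v.1 < n := by
  rcases h with h | ⟨a, b, m, k, h1, h2, -, -, h3, -⟩
  · exact (mem_square.1 h).1
  · omega

theorem Kept.cap_next {e : Bool} {c : Cell B} (h : Kept x n (i, j)) (hc : x (i, j) = .inr c)
    (he : c.cap e = false) : Kept x n (i, j + dir e) := by
  obtain ⟨a, b, m, k, h1, h2, h3, h4, h5, h6, h7⟩ := h
  refine ⟨a, b, m, k, h1, h2, h3, h4, h5, ?_, h7⟩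
  dsimp only at h5 h6 ⊢
  obtain ⟨c', hc', -, hcap⟩ := h7 (j - b).toNat (by omega) (i - a).toNat (by omega)
  rw [show a + ((i - a).toNat : ℤ) = i by omega, show b + ((j - b).toNat : ℤ) = j by omega,
    hc] at hc'
  cases hc'
  rw [hcap] at he
  cases e <;> simp at he ⊢ <;> omega

theorem patch_edge {e : Bool} (hj : j = if e then (n : ℤ) - 1 else 0)
    (hk : ¬ Kept x n (i, j + dir e)) [Decidable (BadEnd x n true j i)] :
    patch x n (i, j + dir e) = .inl (decide (BadEnd x n true j i)) := by
  rw [patch, if_neg]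
  · congr 1
    refine decide_eq_decide.2 ?_
    subst hj
    cases e
    · simp
    · simp
  · rintro (h | h)
    · rw [mem_square] at h
      cases e <;> simp at hj h <;> omega
    · exact hk h

/-- Kept pictures are complete, so new vertical blanks matter only beside uncapped cells of the
square at its top and bottom edges. Such a cell has a bad end, as otherwise its row would be
complete and lie in a kept picture. The bit is `true` exactly when the right end is bad; this is
constant along the row because badness passes between neighbours. -/
theorem patch_mem_pictureShift (hx : x ∈ pictureShift H V) (hnil : Nilpotent H V) :
    patch x n ∈ pictureShift H V := by
  classical
  intro i j c hc
  obtain ⟨hxc, hmem⟩ := patch_eq_inr hc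
  have hval := hx i j c hxc
  refine ⟨hval.side_end, fun s hs c' hc' => hval.side_next s hs c' (patch_eq_inr hc').1,
    hval.cap_end, fun e he c' hc' => hval.cap_next e he c' (patch_eq_inr hc').1,
    fun e s he hs => ?_⟩
  have hnk' : ¬ Kept x n (i, j + dir e) := fun h => by
    obtain ⟨c', hc'⟩ := h.exists_cell
    rw [patch_of_kept h, hc'] at hs
    cases hs
  have hnk : ¬ Kept x n (i, j) := fun h => hnk' (h.cap_next hxc he)
  obtain ⟨⟨hi0, hin⟩, hj0, hjn⟩ := mem_square.1 (hmem.resolve_right hnk)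
  dsimp only at hi0 hin hj0 hjn
  by_cases hS : (i, j + dir e) ∈ square n
  · rw [patch_of_mem_square hS] at hs
    obtain ⟨h1, h2⟩ := hval.blank e s he hs
    refine ⟨h1, fun c' hc' => ?_⟩
    obtain ⟨h3, h4⟩ := patch_eq_inr hc'
    rw [patch_of_mem_square, h2 c' h3]
    exact mem_square.2 ⟨column_bounds (v := (i + dir s, j)) h4, (mem_square.1 hS).2⟩
  · have hj : j = if e then (n : ℤ) - 1 else 0 := by
      rw [mem_square] at hS
      cases e <;> simp at hS ⊢ <;> omega
    rw [patch_edge hj hnk'] at hs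
    have hs' : decide (BadEnd x n true j i) = s := Sum.inl.inj hs
    have hbad : BadEnd x n s j i := by
      cases s
      · by_contra hcon
        obtain ⟨a, m, κ, h1, h2, h3, h4, h5⟩ := exists_isRow_of_not_badEnd hx hi0 hin hxc
          (Bool.forall_bool.2 ⟨hcon, by simpa using hs'⟩)
        obtain ⟨b, k, h6, h7, h8⟩ := h5.exists_isBlock hx hnil (by omega)
        exact hnk ⟨a, b, m, k, h1, h2, by omega, by omega, ⟨h3, h4⟩, ⟨h6, h7⟩, h8⟩
      · simpa using hs'
    refine ⟨hbad.side_eq_false hxc, fun c' hc' => ?_⟩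
    obtain ⟨hxc', hmem'⟩ := patch_eq_inr hc'
    obtain ⟨h1, h2⟩ := column_bounds hmem'
    have hbad' := hbad.next h1 h2 hxc'
    rw [patch_edge hj]
    · congr 1
      cases s
      · refine decide_eq_false fun hbt => ?_
        have hpos : i + dir false + dir true = i := by simp
        have := hbt.next (c' := c) (by omega) (by omega) (by rw [hpos]; exact hxc)
        rw [hpos] at this
        simp [this] at hs'
      · exact decide_eq_true hbad'
    -- A kept picture meets the rows of the square, so if it reached just beyond the edge it would
    -- contain a complete row at height `j`, against `hbad'`.
    · rintro ⟨a, b, m, k, h3, h4, h5, h6, h7, h8, h9⟩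
      dsimp only at h7 h8
      have hrow := h9 (j - b).toNat (by cases e <;> simp at hj h8 <;> omega)
      rw [show b + ((j - b).toNat : ℤ) = j by cases e <;> simp at hj h8 <;> omega] at hrow
      exact hbad'.not_isRow h3 h4 hrow h7

/-- The part of the plane where a completed square pattern lives. -/
def patchBox (n g : ℕ) : Set (ℤ × ℤ) :=
  {v | (0 ≤ v.1 ∧ v.1 < n) ∧ -(g : ℤ) ≤ v.2 ∧ v.2 < n + g}

/-- Kept pictures have width `m ≤ n`, hence height `G m ≤ G n` by monotonicity, and they meet the
square. `0 < G n` makes room for the bits in rows `-1` and `n`. -/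
theorem patch_eq_blank (hx : x ∈ pictureShift H V) {G : ℕ → ℕ} (hG : Realizes H V G)
    (hmono : Monotone G) (hpos : 0 < G n) {v : ℤ × ℤ} (hv : v ∉ patchBox n (G n)) :
    patch x n v = .inl false := by
  classical
  rw [patch, if_neg]
  · congr 1
    refine decide_eq_false fun h => hv ?_
    rcases h with ⟨h1, h2⟩ | ⟨h1, h2⟩ <;>
    · have := h2.bounds
      refine ⟨this, ?_, ?_⟩ <;> omega
  · refine fun h => hv ⟨column_bounds h, ?_⟩
    rcases h with h | ⟨a, b, m, k, h1, h2, h3, h4, h5, h6, h7⟩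
    · have := (mem_square.1 h).2
      omega
    · have hk := h7.height_eq hx hG (by omega) (by omega)
      have : G m ≤ G n := hmono (by omega)
      omega

/-- Completed squares protrude by `G n` rows above and below but not sideways; the extra `2` is the
separation required by `exists_glue`. -/
theorem gluesAt_pictureShift {G : ℕ → ℕ} (hG : Realizes H V G) (hnil : Nilpotent H V)
    (hmono : Monotone G) (hpos : 0 < G n) {v : ℤ × ℤ}
    (hv : (n : ℤ) + 2 ≤ v.1 ∨ (n : ℤ) + 2 * G n + 2 ≤ v.2) :
    GluesAt (pictureShift H V) n v := by
  rw [gluesAt_iff]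
  intro x hx y hy
  have hsub : ∀ u ∈ square n, u ∈ patchBox n (G n) := fun u hu => by
    obtain ⟨h1, h2⟩ := mem_square.1 hu
    exact ⟨h1, by omega, by omega⟩
  obtain ⟨z, hz, h1, h2⟩ := exists_glue (patch_mem_pictureShift (n := n) hx hnil)
    (translate_mem_pictureShift (patch_mem_pictureShift (n := n) hy hnil) (-v.1) (-v.2))
    (S := patchBox n (G n)) (S' := {u | (u.1 + -v.1, u.2 + -v.2) ∈ patchBox n (G n)})
    (fun u hu => patch_eq_blank hx hG hmono hpos hu)
    (fun u hu => patch_eq_blank hy hG hmono hpos hu) (by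
      rintro u ⟨h1, h2⟩ u' ⟨h3, h4⟩ h5 h6
      rw [abs_le] at h5 h6
      dsimp only at h3 h4
      omega)
  refine ⟨z, hz, fun u hu => ?_, fun u hu => ?_⟩
  · rw [h1 u (hsub u hu), patch_of_mem_square hu]
  · have hu' : ((u + v).1 + -v.1, (u + v).2 + -v.2) = u := by
      ext <;> simp
    rw [h2 (u + v)]
    · rw [hu', patch_of_mem_square hu]
    · change ((u + v).1 + -v.1, (u + v).2 + -v.2) ∈ patchBox n (G n)
      rw [hu']
      exact hsub u hu

/-! ### The lower bound -/

/-- The configuration containing the single picture `c` of shape `(m, h)`. -/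
def floating (c : ℕ → ℕ → B) (m h : ℕ) : Config (Bool ⊕ Cell B) := fun v =>
  if (0 ≤ v.1 ∧ v.1 < m) ∧ 0 ≤ v.2 ∧ v.2 < h then
    .inr ⟨c v.1.toNat v.2.toNat, endFlags v.1.toNat m, endFlags v.2.toNat h⟩
  else .inl false

theorem floating_coe {c : ℕ → ℕ → B} {m h p q : ℕ} (hp : p < m) (hq : q < h) :
    floating c m h (p, q) = .inr ⟨c p q, endFlags p m, endFlags q h⟩ := by
  rw [floating, if_pos (by dsimp only; omega)]
  rfl

theorem LineOK.orient_end {R : Option B → Option B → Prop} {u : ℕ → B} {m p : ℕ}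
    (h : LineOK R m u) {s : Bool} (hs : endFlags p m s = true) : orient R s (some (u p)) none := by
  obtain ⟨h1, -, h2⟩ := h
  cases s <;> simp only [endFlags_false, endFlags_true, decide_eq_true_eq] at hs
  · subst hs
    exact h1
  · subst hs
    exact h2

theorem LineOK.orient_next {R : Option B → Option B → Prop} {u : ℕ → B} {m p q : ℕ}
    (h : LineOK R m u) {s : Bool} (hp : p < m) (hq : q < m) (hpq : (p : ℤ) + dir s = q) :
    orient R s (some (u p)) (some (u q)) := by
  obtain ⟨-, h1, -⟩ := h
  cases s
  · obtain rfl : p = q + 1 := by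
      rw [dir_false] at hpq
      omega
    exact h1 q hp
  · obtain rfl : q = p + 1 := by
      rw [dir_true] at hpq
      omega
    exact h1 p hq

theorem endFlags_next {m p q : ℕ} {s : Bool} (hp : p < m)
    (hpq : (p : ℤ) + dir s = q) : endFlags q m (!s) = false := by
  cases s <;> simp at hpq ⊢ <;> omega

theorem floating_mem_pictureShift {c : ℕ → ℕ → B} {m h : ℕ} (hc : IsPic H V m h c) :
    floating c m h ∈ pictureShift H V := by
  have hinr : ∀ i j d, floating c m h (i, j) = .inr d → ∃ p q : ℕ, p < m ∧ q < h ∧ i = p ∧ j = q ∧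
      d = ⟨c p q, endFlags p m, endFlags q h⟩ := by
    intro i j d hd
    have h1 : (0 ≤ i ∧ i < m) ∧ 0 ≤ j ∧ j < h := by
      by_contra hcon
      rw [floating, if_neg hcon] at hd
      cases hd
    refine ⟨i.toNat, j.toNat, by omega, by omega, by omega, by omega, ?_⟩
    rw [floating, if_pos h1] at hd
    exact (Sum.inr.inj hd).symm
  intro i j d hd
  obtain ⟨p, q, hp, hq, rfl, rfl, rfl⟩ := hinr i j d hd
  refine ⟨fun s hs => (hc.1 q hq).orient_end hs, fun s hs d' hd' => ?_,
    fun e he => (hc.2 p hp).orient_end he, fun e he d' hd' => ?_, fun e s he hs => ?_⟩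
  · obtain ⟨p', q', hp', hq', h1, h2, rfl⟩ := hinr _ _ _ hd'
    obtain rfl : q = q' := by omega
    exact ⟨endFlags_next hp h1, rfl, (hc.1 q hq).orient_next hp hp' h1⟩
  · obtain ⟨p', q', hp', hq', h1, h2, rfl⟩ := hinr _ _ _ hd'
    obtain rfl : p = p' := by omega
    exact ⟨endFlags_next hq h2, rfl, (hc.2 p hp).orient_next hq hq' h2⟩
  -- Beside an uncapped cell of the picture there is another of its cells, never a blank.
  · exfalso
    obtain ⟨q', hq', hqq⟩ : ∃ q' : ℕ, q' < h ∧ (q : ℤ) + dir e = q' := by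
      dsimp only at he
      cases e <;> simp at he ⊢
      · exact ⟨q - 1, by omega, by omega⟩
      · exact ⟨q + 1, by omega, by omega⟩
    rw [hqq, floating_coe hp hq'] at hs
    cases hs

/-- Two complete pictures in the same columns are disjoint or equal, since their cap flags agree on
a common row. Disjointness gives the bound. -/
theorem le_of_gluesAt_pictureShift {G : ℕ → ℕ} (hG : Realizes H V G) (hnil : Nilpotent H V)
    (hn : 0 < n) (hpos : 0 < G n) {k : ℕ}
    (hk : GluesAt (pictureShift H V) n (0, (n : ℤ) + k)) : 2 * G n ≤ k + 2 := by
  obtain ⟨c, hc⟩ := (hG n (G n) hn hpos).2 rfl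
  rw [gluesAt_iff] at hk
  set g := G n with hg
  have hmem := floating_mem_pictureShift hc
  have hcol : ∀ i : ℕ, ((i : ℤ), (0 : ℤ)) + (0, (n : ℤ) + k) = (0 + (i : ℤ), (n : ℤ) + k) := by
    intro i
    ext <;> simp
  have hbottom : ∀ z ∈ pictureShift H V,
      (∀ u ∈ square n, z u = floating c n g (u.1 + 0, u.2 + -((n : ℤ) - 1))) →
      IsBlock z 0 ((n : ℤ) - 1) n g := by
    intro z hz h1
    have hrow : IsRow z 0 n ((n : ℤ) - 1) (endFlags 0 g) := by
      intro i hi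
      refine ⟨⟨c i 0, endFlags i n, endFlags 0 g⟩, ?_, rfl, rfl⟩
      rw [zero_add, h1 _ (mem_square.2 (by dsimp only; omega)), ← floating_coe hi hpos]
      simp
    obtain ⟨b, h, hb1, hb2, hb⟩ := hrow.exists_isBlock hz hnil hn
    obtain rfl : h = g := hb.height_eq hz hG hn (by omega)
    have hrow' := hb ((n : ℤ) - 1 - b).toNat (by omega)
    rw [show b + (((n : ℤ) - 1 - b).toNat : ℤ) = (n : ℤ) - 1 by omega] at hrow'
    have := congrFun (hrow.unique hn hrow') false
    simp at this
    obtain rfl : b = (n : ℤ) - 1 := by omega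
    exact hb
  obtain ⟨z, hz, hz1, hz2⟩ := hk _ (translate_mem_pictureShift hmem 0 (-((n : ℤ) - 1))) _
    (translate_mem_pictureShift hmem 0 ((g : ℤ) - 1))
  have hb := hbottom z hz hz1
  have hrow : IsRow z 0 n ((n : ℤ) + k) (endFlags (g - 1) g) := by
    intro i hi
    refine ⟨⟨c i (g - 1), endFlags i n, endFlags (g - 1) g⟩, ?_, rfl, rfl⟩
    rw [← hcol, hz2 _ (mem_square.2 (by dsimp only; omega)), ← floating_coe hi (by omega)]
    congr 2
    simp
    omega
  obtain ⟨b', h', hb1', hb2', hb'⟩ := hrow.exists_isBlock hz hnil hn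
  have hgh : h' = g := hb'.height_eq hz hG hn (by omega)
  rw [hgh] at hb2' hb'
  have htop : b' = (n : ℤ) + k - (g - 1) := by
    have hrow' := hb' ((n : ℤ) + k - b').toNat (by omega)
    rw [show b' + (((n : ℤ) + k - b').toNat : ℤ) = (n : ℤ) + k by omega] at hrow'
    have := congrFun (hrow.unique hn hrow') true
    rw [endFlags_true, endFlags_true, decide_eq_decide] at this
    omega
  by_contra hlt
  -- If the pictures overlap, the top row of one is a row of the other, hence its top row too. So
  -- they coincide, which fixes `k`.
  have hkg : k + 2 = g := by
    rcases Nat.lt_or_ge g (k + 2) with h1 | h1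
    · have h2 := hb (g - 1) (by omega)
      have h3 := hb' (2 * g - 3 - k) (by omega)
      rw [show b' + ((2 * g - 3 - k : ℕ) : ℤ) = (n : ℤ) - 1 + ((g - 1 : ℕ) : ℤ) by omega] at h3
      have := congrFun (h2.unique hn h3) true
      rw [endFlags_true, endFlags_true, decide_eq_decide] at this
      omega
    · have h2 := hb (k + 1) (by omega)
      rw [show (n : ℤ) - 1 + ((k + 1 : ℕ) : ℤ) = (n : ℤ) + k by push_cast; ring] at h2
      have := congrFun (hrow.unique hn h2) true
      rw [endFlags_true, endFlags_true, decide_eq_decide] at this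
      omega
  -- The remaining gap `k = g - 2` fails for a blank upper square, because the forced picture
  -- reaches into it.
  obtain ⟨z', hz', hz1', hz2'⟩ := hk _ (translate_mem_pictureShift hmem 0 (-((n : ℤ) - 1))) _
    blank_mem_pictureShift
  obtain ⟨d, hd, -⟩ := hbottom z' hz' hz1' (k + 1) (by omega) 0 hn
  have h0 := hz2' ((0 : ℕ), 0) (mem_square.2 (by simp; omega))
  rw [hcol, show (n : ℤ) + k = (n : ℤ) - 1 + ((k + 1 : ℕ) : ℤ) by push_cast; ring, hd] at h0
  cases h0

end BlockGluing

namespace BlockGluing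

/-! ### Product with the transpose -/

/-- The product of a subshift and its transpose. -/
def transposeProd {A : Type} (X : Set (Config A)) : Set (Config (A × A)) :=
  {x | (fun v => (x v).1) ∈ X ∧ (fun v => (x v.swap).2) ∈ X}

theorem swap_mem_square {n : ℕ} {v : ℤ × ℤ} : v.swap ∈ square n ↔ v ∈ square n := by
  rw [mem_square, mem_square]
  exact and_comm

/-- The layers are independent and the second sees the offset as `v.swap`, so each gluing problem
for the product combines both directions of `X`. -/
theorem GluesAt.transposeProd {A : Type} {X : Set (Config A)} {n : ℕ} {v : ℤ × ℤ}
    (h : GluesAt X n v) (h' : GluesAt X n v.swap) : GluesAt (transposeProd X) n v := by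
  rw [gluesAt_iff] at *
  rintro x ⟨hx, hx'⟩ y ⟨hy, hy'⟩
  obtain ⟨z, hz, h1, h2⟩ := h _ hx _ hy
  obtain ⟨z', hz', h1', h2'⟩ := h' _ hx' _ hy'
  refine ⟨fun u => (z u, z' u.swap), ⟨hz, by simpa using hz'⟩, fun u hu => ?_, fun u hu => ?_⟩
  · exact Prod.ext (h1 u hu) (h1' u.swap (swap_mem_square.2 hu))
  · exact Prod.ext (h2 u hu) (h2' u.swap (swap_mem_square.2 hu))

theorem GluesAt.of_transposeProd {A : Type} {X : Set (Config A)} {n : ℕ} {v : ℤ × ℤ}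
    (h : GluesAt (BlockGluing.transposeProd X) n v) : GluesAt X n v := by
  rw [gluesAt_iff] at *
  intro x hx y hy
  obtain ⟨z, ⟨hz, -⟩, h1, h2⟩ := h (fun u => (x u, x u.swap)) ⟨hx, by simpa using hx⟩
    (fun u => (y u, y u.swap)) ⟨hy, by simpa using hy⟩
  exact ⟨_, hz, fun u hu => congrArg Prod.fst (h1 u hu), fun u hu => congrArg Prod.fst (h2 u hu)⟩

theorem GluesAt.of_transposeProd_swap {A : Type} {X : Set (Config A)} {n : ℕ} {v : ℤ × ℤ}
    (h : GluesAt (BlockGluing.transposeProd X) n v) : GluesAt X n v.swap := by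
  rw [gluesAt_iff] at *
  intro x hx y hy
  obtain ⟨z, ⟨-, hz⟩, h1, h2⟩ := h (fun u => (x u, x u.swap)) ⟨hx, by simpa using hx⟩
    (fun u => (y u, y u.swap)) ⟨hy, by simpa using hy⟩
  refine ⟨_, hz, fun u hu => ?_, fun u hu => ?_⟩
  · exact congrArg Prod.snd (h1 u.swap (swap_mem_square.2 hu))
  · exact congrArg Prod.snd (h2 u.swap (swap_mem_square.2 hu))

/-- The `3 × 3` neighbourhood of the origin. -/
noncomputable def window : Finset (ℤ × ℤ) := Finset.Icc (-1) 1 ×ˢ Finset.Icc (-1) 1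

theorem mem_window {v : ℤ × ℤ} : v ∈ window ↔ |v.1| ≤ 1 ∧ |v.2| ≤ 1 := by
  simp [window, abs_le]

theorem isSFT_transposeProd_pictureShift {B : Type} [Finite B] (H V : Option B → Option B → Prop) :
    IsSFT (transposeProd (pictureShift H V)) := by
  let P : Config (Bool ⊕ Cell B) → Prop := fun z => ∀ c, z (0, 0) = .inr c → ValidAt H V z 0 0 c
  have hP : ∀ z z' : Config (Bool ⊕ Cell B), (∀ d ∈ window, z d = z' d) → P z → P z' := by
    intro z z' h hz c hc
    have h0 := h (0, 0) (mem_window.2 (by simp))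
    exact (hz c (h0.trans hc)).congr fun a b ha hb => by
      simpa using h (a, b) (mem_window.2 ⟨ha, hb⟩)
  have hmem : ∀ x, x ∈ pictureShift H V ↔ ∀ v, P (shift v x) := by
    intro x
    have hshift : ∀ i j a b : ℤ, shift (i, j) x (0 + a, 0 + b) = x (i + a, j + b) := by
      intro i j a b
      simp [shift, add_comm]
    have hshift0 : ∀ i j : ℤ, shift (i, j) x (0, 0) = x (i, j) := by
      simp [shift]
    constructor
    · rintro hx ⟨i, j⟩ c hc
      rw [hshift0] at hc
      exact (hx i j c hc).congr fun a b _ _ => (hshift i j a b).symm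
    · intro hx i j c hc
      exact (hx (i, j) c ((hshift0 i j).trans hc)).congr fun a b _ _ => hshift i j a b
  have := isSFT_of_local (A := (Bool ⊕ Cell B) × (Bool ⊕ Cell B)) window
    (fun z => P (fun v => (z v).1) ∧ P fun v => (z v.swap).2) fun z z' h hz =>
      ⟨hP _ _ (fun d hd => congrArg Prod.fst (h d hd)) hz.1,
        hP _ _ (fun d hd => congrArg Prod.snd (h d.swap
          (mem_window.2 (mem_window.1 hd).symm))) hz.2⟩
  convert this using 1
  ext x
  simp only [transposeProd, Set.mem_ofPred_eq, hmem, forall_and]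
  refine and_congr Iff.rfl ⟨fun h v => ?_, fun h v => ?_⟩
  · exact h v.swap
  · exact h v.swap

/-! ### Asymptotics -/

theorem horizontalGluing_le {A : Type} {X : Set (Config A)} {n k : ℕ}
    (h : GluesAt X n ((n : ℤ) + k, 0)) : horizontalGluing X n ≤ k :=
  iInf₂_le k h

theorem verticalGluing_le {A : Type} {X : Set (Config A)} {n k : ℕ}
    (h : GluesAt X n (0, (n : ℤ) + k)) : verticalGluing X n ≤ k :=
  iInf₂_le k h

theorem le_horizontalGluing {A : Type} {X : Set (Config A)} {n l : ℕ}
    (h : ∀ k : ℕ, GluesAt X n ((n : ℤ) + k, 0) → l ≤ k) : (l : ℕ∞) ≤ horizontalGluing X n :=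
  le_iInf₂ fun k hk => Nat.cast_le.2 (h k hk)

theorem le_verticalGluing {A : Type} {X : Set (Config A)} {n l : ℕ}
    (h : ∀ k : ℕ, GluesAt X n (0, (n : ℤ) + k) → l ≤ k) : (l : ℕ∞) ≤ verticalGluing X n :=
  le_iInf₂ fun k hk => Nat.cast_le.2 (h k hk)

theorem AsymptoticTo.of_eventuallyEq {u : ℕ → ℕ∞} {f : ℕ+ → ℕ+}
    (h : ∀ᶠ n : ℕ+ in atTop, u n = (f n : ℕ)) : AsymptoticTo u f := by
  refine tendsto_const_nhds.congr' (h.mono fun n hn => ?_)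
  beta_reduce
  rw [hn, ENat.toENNReal_coe, ENNReal.div_self] <;> simp

/-- The quotient is squeezed between `1 - 2 / f n` and `1 + 3 / f n`. -/
theorem AsymptoticTo.of_bounds {u : ℕ → ℕ∞} {f : ℕ+ → ℕ+}
    (hf : Tendsto (fun n => (f n : ℕ)) atTop atTop) (hl : ∀ n : ℕ+, ((f n - 2 : ℕ) : ℕ∞) ≤ u n)
    (hu : ∀ n : ℕ+, u n ≤ ((f n + 3 : ℕ) : ℕ∞)) : AsymptoticTo u f := by
  have hreal : ∀ c : ℝ, Tendsto (fun n : ℕ+ => ENNReal.ofReal (1 + c / (f n : ℕ))) atTop (𝓝 1) := by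
    intro c
    have h1 : Tendsto (fun n : ℕ+ => c / ((f n : ℕ) : ℝ)) atTop (𝓝 0) :=
      tendsto_const_nhds.div_atTop (tendsto_natCast_atTop_atTop.comp hf)
    simpa using ENNReal.tendsto_ofReal (h1.const_add 1)
  have hdiv : ∀ (n : ℕ+) (a : ℕ), ((a : ℕ∞) : ℝ≥0∞) / ((f n : ℕ) : ℝ≥0∞) =
      ENNReal.ofReal ((a : ℝ) / ((f n : ℕ) : ℝ)) := by
    intro n a
    rw [ENNReal.ofReal_div_of_pos (by exact_mod_cast (f n).pos), ENNReal.ofReal_natCast,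
      ENNReal.ofReal_natCast, ENat.toENNReal_coe]
  refine tendsto_of_tendsto_of_tendsto_of_le_of_le (hreal (-2)) (hreal 3) (fun n => ?_) fun n => ?_
  · have hpos : (0 : ℝ) < (f n : ℕ) := by exact_mod_cast (f n).pos
    calc _ ≤ ENNReal.ofReal (((f n - 2 : ℕ) : ℝ) / ((f n : ℕ) : ℝ)) := by
          refine ENNReal.ofReal_le_ofReal ?_
          rw [le_div_iff₀ hpos, add_mul, div_mul_cancel₀ _ hpos.ne']
          have : ((f n : ℕ) : ℝ) ≤ ((f n - 2 : ℕ) : ℝ) + 2 := by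
            exact_mod_cast (by omega : (f n : ℕ) ≤ (f n - 2) + 2)
          linarith
      _ = _ := (hdiv n _).symm
      _ ≤ _ := ENNReal.div_le_div_right (ENat.toENNReal_le.2 (hl n)) _
  · have hpos : (0 : ℝ) < (f n : ℕ) := by exact_mod_cast (f n).pos
    calc _ ≤ (((f n + 3 : ℕ) : ℕ∞) : ℝ≥0∞) / ((f n : ℕ) : ℝ≥0∞) :=
          ENNReal.div_le_div_right (ENat.toENNReal_le.2 (hu n)) _
      _ = _ := hdiv n _
      _ ≤ _ := by
          refine ENNReal.ofReal_le_ofReal (le_of_eq ?_)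
          push_cast
          field_simp

theorem exists_isSFT_of_tendsto {f : ℕ+ → ℕ+} (hmono : Monotone f)
    (hrec : IsRecognizableFunction f) (hf : Tendsto (fun n => (f n : ℕ)) atTop atTop) :
    ∃ (A : Type) (_ : Finite A) (X : Set (Config A)), IsSFT X ∧ AsymptoticTo (blockGluing X) f ∧
      AsymptoticTo (verticalGluing X) f ∧ AsymptoticTo (horizontalGluing X) f := by
  classical
  obtain ⟨B, hB, H, V, hF⟩ := hrec.exists_realizes
  let D := B × Option B
  let _ : Fintype D := Fintype.ofFinite D
  -- Any order serves. `D` is the folded alphabet itself, so `Realizes.le_card_pow` supplies the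
  -- cardinality bound.
  let _ : LinearOrder D := linearOrderOfSTO WellOrderingRel
  set G : ℕ → ℕ := fun m => ((f m.toPNat' : ℕ) + 1) / 2 with hGdef
  have hGpos : ∀ m, 0 < G m := fun m => by
    have := (f m.toPNat').pos
    simp only [hGdef]
    omega
  have hG : Realizes (lexH (D := D) (pairH H)) (lexV (pairV V)) G := by
    have h1 : Realizes (pairH H) (pairV V) G := hF.pair fun m => (f m.toPNat').pos
    exact h1.lex fun m hm => h1.le_card_pow hGpos hm
  have hnil := nilpotent_lex (D := D) (pairH H) (pairV V)
  -- At `0` the default `toPNat' 0 = 1` gives `G 0 = G 1`, which keeps `G` monotone.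
  have hGmono : Monotone G := fun m m' h => by
    have h1 : m.toPNat' ≤ m'.toPNat' := by
      rw [← PNat.coe_le_coe, Nat.toPNat'_coe, Nat.toPNat'_coe]
      split_ifs <;> omega
    have h2 : (f m.toPNat' : ℕ) ≤ f m'.toPNat' := hmono h1
    simp only [hGdef]
    omega
  have hGf : ∀ n : ℕ+, G n = (f n + 1) / 2 := fun n => by simp [hGdef]
  set X := pictureShift (lexH (D := D) (pairH H)) (lexV (pairV V)) with hX
  have hglue : ∀ (n : ℕ+) (v : ℤ × ℤ), v = (((n : ℕ) : ℤ) + ((2 * G n + 2 : ℕ) : ℤ), 0) ∨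
      v = (0, ((n : ℕ) : ℤ) + ((2 * G n + 2 : ℕ) : ℤ)) → GluesAt X n v := by
    rintro n v (rfl | rfl) <;> refine gluesAt_pictureShift hG hnil hGmono (hGpos n) ?_
    · left
      push_cast
      omega
    · right
      push_cast
      omega
  -- Since `2 * G n` is `f n` or `f n + 1`, the bounds `2 * G n - 2` and `2 * G n + 2` lie within `f
  -- n - 2` and `f n + 3`.
  have hVl : ∀ n : ℕ+, ((f n - 2 : ℕ) : ℕ∞) ≤ verticalGluing (transposeProd X) n := fun n =>
    le_verticalGluing fun k hk => by
      have := le_of_gluesAt_pictureShift hG hnil n.pos (hGpos n) hk.of_transposeProd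
      have := hGf n
      omega
  have hHl : ∀ n : ℕ+, ((f n - 2 : ℕ) : ℕ∞) ≤ horizontalGluing (transposeProd X) n := fun n =>
    le_horizontalGluing fun k hk => by
      have := le_of_gluesAt_pictureShift hG hnil n.pos (hGpos n) hk.of_transposeProd_swap
      have := hGf n
      omega
  have hle : ∀ n : ℕ+, ((2 * G n + 2 : ℕ) : ℕ∞) ≤ ((f n + 3 : ℕ) : ℕ∞) := fun n => by
    have := hGf n
    exact Nat.cast_le.2 (by omega)
  have hVu : ∀ n : ℕ+, verticalGluing (transposeProd X) n ≤ ((f n + 3 : ℕ) : ℕ∞) := fun n =>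
    (verticalGluing_le ((hglue n _ (.inr rfl)).transposeProd (hglue n _ (.inl rfl)))).trans (hle n)
  have hHu : ∀ n : ℕ+, horizontalGluing (transposeProd X) n ≤ ((f n + 3 : ℕ) : ℕ∞) := fun n =>
    (horizontalGluing_le ((hglue n _ (.inl rfl)).transposeProd (hglue n _ (.inr rfl)))).trans
      (hle n)
  exact ⟨_, inferInstance, transposeProd X, isSFT_transposeProd_pictureShift _ _,
    .of_bounds hf (fun n => (hHl n).trans (le_max_left _ _)) fun n => max_le (hHu n) (hVu n),
    .of_bounds hf hVl hVu, .of_bounds hf hHl hHu⟩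

/-! ### Bounded functions -/

/-- The binary configurations in which the distance between two `true` cells of the same row or
column exceeds `c`. -/
def sparseShift (c : ℕ) : Set (Config Bool) :=
  {x | ∀ v : ℤ × ℤ, x v = true → ∀ i : ℤ, 0 < i → i ≤ c →
    x (v.1 + i, v.2) = false ∧ x (v.1, v.2 + i) = false}

theorem isSFT_sparseShift (c : ℕ) : IsSFT (sparseShift c) := by
  have := isSFT_of_local (A := Bool) (Finset.Icc 0 (c : ℤ) ×ˢ Finset.Icc 0 (c : ℤ))
    (fun z => z (0, 0) = true → ∀ i : ℤ, 0 < i → i ≤ c → z (i, 0) = false ∧ z (0, i) = false)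
    fun z z' h hz h0 i hi hic => by
      rw [← h _ (by simp)] at h0
      rw [← h _ (by simp; omega), ← h _ (by simp; omega)]
      exact hz h0 i hi hic
  convert this using 1
  ext x
  simp [sparseShift, shift, add_comm]

/-- With `false` outside both squares, two cells from different squares on a common line are more
than `c` apart. -/
theorem gluesAt_sparseShift {c n : ℕ} {v : ℤ × ℤ}
    (hv : v = ((n : ℤ) + c, 0) ∨ v = (0, (n : ℤ) + c)) : GluesAt (sparseShift c) n v := by
  classical
  rw [gluesAt_iff]
  intro x hx y hy
  have hdisj : ∀ u ∈ square n, u + v ∉ square n := fun u hu hu' => by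
    rw [mem_square] at hu hu'
    rcases hv with rfl | rfl <;> simp at hu hu' <;> omega
  let z : Config Bool := fun u =>
    if u ∈ square n then x u else if u - v ∈ square n then y (u - v) else false
  have hz : ∀ u, z u = true →
      (u ∈ square n ∧ x u = true) ∨ (u - v ∈ square n ∧ y (u - v) = true) := by
    intro u hu
    simp only [z] at hu
    split_ifs at hu with h1 h2
    · exact .inl ⟨h1, hu⟩
    · exact .inr ⟨h2, hu⟩
  have key : ∀ (u d : ℤ × ℤ) (i : ℤ), z u = true → 0 < i → i ≤ c → (d = (i, 0) ∨ d = (0, i)) →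
      z (u + d) = false := by
    intro u d i hu hi hic hd
    have hsparse : ∀ w ∈ sparseShift c, ∀ u, w u = true → w (u + d) ≠ true := by
      intro w hw u hu hwd
      have := hw u hu i hi hic
      rcases hd with rfl | rfl
      · rw [show u + (i, 0) = (u.1 + i, u.2) by ext <;> simp, this.1] at hwd
        cases hwd
      · rw [show u + (0, i) = (u.1, u.2 + i) by ext <;> simp, this.2] at hwd
        cases hwd
    by_contra hcon
    rcases hz u hu with ⟨h1, h2⟩ | ⟨h1, h2⟩ <;>
    rcases hz (u + d) (by simpa using hcon) with ⟨h3, h4⟩ | ⟨h3, h4⟩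
    · exact hsparse x hx u h2 h4
    · rw [mem_square] at h1 h3
      rcases hv with rfl | rfl <;> rcases hd with rfl | rfl <;> simp at h1 h3 <;> omega
    · rw [mem_square] at h1 h3
      rcases hv with rfl | rfl <;> rcases hd with rfl | rfl <;> simp at h1 h3 <;> omega
    · rw [add_sub_right_comm] at h4
      exact hsparse y hy _ h2 h4
  refine ⟨z, fun u hu i hi hic => ⟨?_, ?_⟩, fun u hu => if_pos hu, fun u hu => ?_⟩
  · rw [show (u.1 + i, u.2) = u + (i, 0) by ext <;> simp]
    exact key u _ i hu hi hic (.inl rfl)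
  · rw [show (u.1, u.2 + i) = u + (0, i) by ext <;> simp]
    exact key u _ i hu hi hic (.inr rfl)
  · simp only [z]
    rw [if_neg (hdisj u hu), add_sub_cancel_right, if_pos hu]

/-- A single `true` cell on each of the two facing sides gives distance `k + 1`, which must exceed
`c`. -/
theorem le_of_gluesAt_sparseShift {c n k : ℕ} (hn : 0 < n) {v : ℤ × ℤ}
    (hv : v = ((n : ℤ) + k, 0) ∨ v = (0, (n : ℤ) + k)) (h : GluesAt (sparseShift c) n v) :
    c ≤ k := by
  rw [gluesAt_iff] at h
  have hmem : ∀ w : ℤ × ℤ, (fun u => decide (u = w)) ∈ sparseShift c := by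
    intro w u hu i hi _
    obtain rfl := of_decide_eq_true hu
    constructor <;> refine decide_eq_false fun h => ?_
    · have := congrArg Prod.fst h
      dsimp only at this
      omega
    · have := congrArg Prod.snd h
      dsimp only at this
      omega
  by_contra hlt
  rcases hv with rfl | rfl
  · obtain ⟨z, hz, h1, h2⟩ := h _ (hmem ((n : ℤ) - 1, 0)) _ (hmem (0, 0))
    have h3 := h1 ((n : ℤ) - 1, 0) (mem_square.2 (by simp; omega))
    have h4 := h2 (0, 0) (mem_square.2 (by simp; omega))
    have h5 := (hz _ (h3.trans (decide_eq_true rfl)) (k + 1) (by omega) (by omega)).1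
    rw [decide_eq_true rfl] at h4
    simp only [Prod.mk_add_mk, zero_add] at h4
    rw [show (n : ℤ) - 1 + (k + 1) = n + k by ring, h4] at h5
    cases h5
  · obtain ⟨z, hz, h1, h2⟩ := h _ (hmem (0, (n : ℤ) - 1)) _ (hmem (0, 0))
    have h3 := h1 (0, (n : ℤ) - 1) (mem_square.2 (by simp; omega))
    have h4 := h2 (0, 0) (mem_square.2 (by simp; omega))
    have h5 := (hz _ (h3.trans (decide_eq_true rfl)) (k + 1) (by omega) (by omega)).2
    rw [decide_eq_true rfl] at h4
    simp only [Prod.mk_add_mk, zero_add] at h4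
    rw [show (n : ℤ) - 1 + (k + 1) = n + k by ring, h4] at h5
    cases h5

/-- For bounded `f` an additive error would not vanish in the quotient, so the value must be hit
exactly. -/
theorem exists_isSFT_of_eventually_eq {f : ℕ+ → ℕ+} {c : ℕ}
    (hf : ∀ᶠ n in atTop, (f n : ℕ) = c) :
    ∃ (A : Type) (_ : Finite A) (X : Set (Config A)), IsSFT X ∧ AsymptoticTo (blockGluing X) f ∧
      AsymptoticTo (verticalGluing X) f ∧ AsymptoticTo (horizontalGluing X) f := by
  have hV : ∀ n : ℕ+, verticalGluing (sparseShift c) n = c := fun n =>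
    le_antisymm (verticalGluing_le (gluesAt_sparseShift (.inr rfl)))
      (le_verticalGluing fun k hk => le_of_gluesAt_sparseShift n.pos (.inr rfl) hk)
  have hH : ∀ n : ℕ+, horizontalGluing (sparseShift c) n = c := fun n =>
    le_antisymm (horizontalGluing_le (gluesAt_sparseShift (.inl rfl)))
      (le_horizontalGluing fun k hk => le_of_gluesAt_sparseShift n.pos (.inl rfl) hk)
  refine ⟨Bool, inferInstance, sparseShift c, isSFT_sparseShift c, .of_eventuallyEq ?_,
    .of_eventuallyEq ?_, .of_eventuallyEq ?_⟩ <;> filter_upwards [hf] with n hn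
  · rw [blockGluing, hV, hH, max_self, hn]
  · rw [hV, hn]
  · rw [hH, hn]

theorem tendsto_or_eventually_eq {f : ℕ+ → ℕ+} (hmono : Monotone f) :
    Tendsto (fun n => (f n : ℕ)) atTop atTop ∨ ∃ c : ℕ, ∀ᶠ n in atTop, (f n : ℕ) = c := by
  have hmono' : Monotone fun n => (f n : ℕ) := fun a b h => hmono h
  rcases tendsto_atTop_of_monotone hmono' with h | ⟨c, hc⟩
  · exact .inl h
  · rw [nhds_discrete, tendsto_pure] at hc
    exact .inr ⟨c, hc⟩

end BlockGluing

theorem mainTheorem3 (f : ℕ+ → ℕ+) (hmono : Monotone f)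
    (hrec : BlockGluing.IsRecognizableFunction f) :
    ∃ (A : Type) (_ : Finite A) (X : Set (BlockGluing.Config A)),
      BlockGluing.IsSFT X ∧
      BlockGluing.AsymptoticTo (BlockGluing.blockGluing X) f ∧
      BlockGluing.AsymptoticTo (BlockGluing.verticalGluing X) f ∧
      BlockGluing.AsymptoticTo (BlockGluing.horizontalGluing X) f := by
  rcases BlockGluing.tendsto_or_eventually_eq hmono with hf | ⟨c, hc⟩
  · exact BlockGluing.exists_isSFT_of_tendsto hmono hrec hf
  · exact BlockGluing.exists_isSFT_of_eventually_eq hc
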